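/- Let $N,m,k$ be natural numbers with $m<N$ and $1\le k\le m-1$. For $0<\alpha<N$ put $$\gamma(\alpha)=\pi^{N/2}\,2^{\alpha}\,\frac{\Gamma(\alpha/2)}{\Gamma((N-\alpha)/2)},\qquad I_\alpha g(x)=\frac1{\gamma(\alpha)}\int_{\mathbb R^N}\frac{g(y)}{|x-y|^{N-\alpha}}\,dy,$$ and let $(-\Delta)^{\alpha/2}$ be the Fourier multiplier operator $\big((-\Delta)^{\alpha/2}g\big)^{\wedge}(\xi)=(2\pi|\xi|)^{\alpha}\,\widehat g(\xi)$, where $\widehat g(\xi)=\int_{\mathbb R^N} g(x)e^{-2\pi i x\cdot\xi}\,dx$. For a smooth function $f$ let $|\nabla^k f|(x)=\big(\sum_{i_1,\dots,i_k=1}^N|\partial_{i_1}\cdots\partial_{i_k}f(x)|^2\big)^{1/2}$. For $s\in\mathbb R$ and an integer $k\geq 1$ let $$\lambda_N^{s,k}=k!\sum_{l=0}^{\lfloor k/2\rfloor}(k-2l)!\,l!\,\Big(\tfrac{N-3}2+l\Big)_l\Big(\sum_{n=\lceil k/2\rceil}^{k-l}2^{2n-k+l}\binom{s/2}{n}\binom{n}{k-n}\binom{k-n}{l}\Big)^2,$$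 where $(\nu)_l=\prod_{j=0}^{l-1}(\nu-j)$, with $(\nu)_0=1$, and $\binom{\nu}{n}=(\nu)_n/n!$; this is the constant for which $|\nabla^k|x|^s|^2=\lambda_N^{s,k}|x|^{-2(k-s)}$ for all $x\neq0$. Then for every (real- or complex-valued) $u\in C_c^\infty(\mathbb R^N)$ and every $x\in\mathbb R^N$ the integral defining $I_m|\nabla^k(-\Delta)^{(m-k)/2}u|(x)$ converges absolutely, and $$|u(x)|\le\frac{\gamma(m)}{\gamma(m-k)\sqrt{\lambda_N^{k-m,k}}}\;I_m\big|\nabla^k(-\Delta)^{(m-k)/2}u\big|(x).$$ -/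

import Mathlib

open scoped FourierTransform ContDiff Nat

noncomputable section

namespace PotentialEstimate

/-- Falling factorial `(ν)_k = ν (ν - 1) ⋯ (ν - k + 1)` of a real number, with `(ν)_0 = 1`. -/
def fallingFactorial (ν : ℝ) (k : ℕ) : ℝ := ∏ j ∈ Finset.range k, (ν - (j : ℝ))

/-- Generalized binomial coefficient `binom(ν, n) = (ν)_n / n!` for real `ν`. -/
def realBinom (ν : ℝ) (n : ℕ) : ℝ := fallingFactorial ν n / (n ! : ℝ)

/-- The constant `λ_N^{s,m}`, given by
`m! ∑_{l=0}^{⌊m/2⌋} (m-2l)! l! ((N-3)/2+l)_l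
  (∑_{n=⌈m/2⌉}^{m-l} 2^{2n-m+l} binom(s/2,n) binom(n,m-n) binom(m-n,l))²`.
All natural-number subtractions below are exact on the ranges of summation, and
`(m + 1) / 2` is `⌈m/2⌉`. -/
def lam (N : ℕ) (s : ℝ) (m : ℕ) : ℝ :=
  (m ! : ℝ) * ∑ l ∈ Finset.Icc 0 (m / 2),
    ((m - 2 * l)! : ℝ) * (l ! : ℝ) * fallingFactorial (((N : ℝ) - 3) / 2 + (l : ℝ)) l *
      (∑ n ∈ Finset.Icc ((m + 1) / 2) (m - l),
        (2 : ℝ) ^ (2 * n - m + l) * realBinom (s / 2) n *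
          (n.choose (m - n) : ℝ) * ((m - n).choose l : ℝ)) ^ 2

/-- The normalization constant `γ(α) = π^{N/2} 2^α Γ(α/2) / Γ((N-α)/2)`. -/
def rieszGamma (N : ℕ) (α : ℝ) : ℝ :=
  Real.pi ^ ((N : ℝ) / 2) * (2 : ℝ) ^ α * Real.Gamma (α / 2) / Real.Gamma (((N : ℝ) - α) / 2)

/-- The Riesz potential `I_α g (x) = γ(α)⁻¹ ∫ g(y) / |x - y|^{N - α} dy` on `ℝ^N`. -/
def rieszPotential {N : ℕ} (α : ℝ) (g : EuclideanSpace ℝ (Fin N) → ℝ)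
    (x : EuclideanSpace ℝ (Fin N)) : ℝ :=
  1 / rieszGamma N α * ∫ y, g y / ‖x - y‖ ^ ((N : ℝ) - α)

/-- The fractional Laplacian `(-Δ)^{α/2} g`, the inverse Fourier transform of
`(2π|ξ|)^α ĝ(ξ)`, with the convention `ĝ(ξ) = ∫ g(x) e^{-2πi x·ξ} dx`. -/
def fracLaplacian {N : ℕ} (α : ℝ) (g : EuclideanSpace ℝ (Fin N) → ℂ) :
    EuclideanSpace ℝ (Fin N) → ℂ :=
  𝓕⁻ (fun ξ : EuclideanSpace ℝ (Fin N) => (((2 * Real.pi * ‖ξ‖) ^ α : ℝ) : ℂ) * 𝓕 g ξ)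

/-- The Euclidean length `|∇^k f|(x) = (∑_{i_1,…,i_k} |∂_{i_1} ⋯ ∂_{i_k} f(x)|²)^{1/2}`
of the tensor of all partial derivatives of order `k`. -/
def gradNorm {N : ℕ} (k : ℕ) (f : EuclideanSpace ℝ (Fin N) → ℂ)
    (x : EuclideanSpace ℝ (Fin N)) : ℝ :=
  Real.sqrt (∑ i : Fin k → Fin N,
    ‖iteratedFDeriv ℝ k f x (fun j => EuclideanSpace.single (i j) (1 : ℝ))‖ ^ 2)

end PotentialEstimate

end

noncomputable section

namespace PotentialEstimate

/-! ### Falling factorials and the constant `lam` -/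

/-! Put a = m - k, s = -a, g = û and f = (-Δ)^{a/2}u. For N = 1 one would integrate by parts in u =
I_a f; here the same effect is obtained by contracting ∇^k f(x - z) with the tensor T(z) = ∇^k|z|^s
and integrating against |z|^{2m-N}.

The generating polynomial of T is (ξ·∇)^k|z|^s = ∑_b c_b |z|^{s-2(k-b)} (z·ξ)^{k-2b} |ξ|^{2b}, with
c_b = `radialCoeff s k b`. Replacing ξ by ∂ and applying the result to f, the factor |ξ|^{2b}
becomes Δ^b and turns f into (-1)^b (-Δ)^{(a+2b)/2}u, while (z·∂)^{k-2b} is a radial derivative. By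
scaling, ∫ |z|^{α-N} F(x - rz) dz is a multiple of r^{-α}; differentiating in r at r = 1 replaces
radial derivatives by falling factorials, and I_α inverts (-Δ)^{α/2}
(`integral_rpow_mul_radial_deriv`). As (-1)^b γ(a+2b) = `lapFactor N (-a) b` γ(a), the whole
integral is (-1)^k γ(a) Λ u(x), where Λ = ∑_b c_b `lapFactor N s b` (s-2b)_{k-2b}.

Applying the same polynomial to |z|^s itself instead of f gives |T(z)|² = Λ|z|^{2(s-k)}
(`sum_radialTensor_sq`), and binomial identities identify Λ with λ (`sum_radialCoeff_mul_eq_lam`).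
Cauchy–Schwarz then yields γ(a) λ |u(x)| ≤ √λ ∫ |z|^{m-N} |∇^k f|(x - z) dz, and λ > 0 permits
division.

The analytic work is the decay of f: its symbol is singular at 0, so only finitely many powers of
|y| can be gained (`exists_iteratedFDeriv_fracMul_bound`), but enough for every integral above. -/

@[simp] lemma fallingFactorial_zero (ν : ℝ) : fallingFactorial ν 0 = 1 := by
  simp [fallingFactorial]

lemma fallingFactorial_succ (ν : ℝ) (n : ℕ) :
    fallingFactorial ν (n + 1) = fallingFactorial ν n * (ν - n) := by
  simp [fallingFactorial, Finset.prod_range_succ]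

lemma fallingFactorial_add (ν : ℝ) (a b : ℕ) :
    fallingFactorial ν (a + b) = fallingFactorial ν a * fallingFactorial (ν - a) b := by
  simp only [fallingFactorial, Finset.prod_range_add]
  congr 1
  refine Finset.prod_congr rfl fun j _ => ?_
  push_cast; ring

lemma fallingFactorial_two_mul (ν : ℝ) (p : ℕ) :
    fallingFactorial ν (2 * p) =
      4 ^ p * fallingFactorial (ν / 2) p * fallingFactorial ((ν - 1) / 2) p := by
  induction p with
  | zero => simp
  | succ p ih =>
    rw [show 2 * (p + 1) = 2 * p + 1 + 1 by ring, fallingFactorial_succ, fallingFactorial_succ, ih,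
      fallingFactorial_succ, fallingFactorial_succ]
    push_cast; ring

lemma neg_one_pow_mul_fallingFactorial (w : ℝ) (l : ℕ) :
    (-1) ^ l * fallingFactorial w l = fallingFactorial (l - 1 - w) l := by
  have h1 : (-1 : ℝ) ^ l = ∏ _j ∈ Finset.range l, (-1 : ℝ) := by simp
  rw [fallingFactorial, fallingFactorial, ← Finset.prod_range_reflect, h1,
    ← Finset.prod_mul_distrib]
  refine Finset.prod_congr rfl fun j hj => ?_
  have : j + 1 ≤ l := Finset.mem_range.1 hj
  rw [show l - 1 - j = l - (j + 1) by omega, Nat.cast_sub this]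
  push_cast; ring

lemma fallingFactorial_eq_eval (ν : ℝ) (n : ℕ) :
    fallingFactorial ν n = (descPochhammer ℝ n).eval ν :=
  (descPochhammer_eval_eq_prod_range n ν).symm

lemma fallingFactorial_add_left (a b : ℝ) (k : ℕ) :
    fallingFactorial (a + b) k = ∑ i ∈ Finset.range (k + 1),
      (k.choose i : ℝ) * (fallingFactorial a i * fallingFactorial b (k - i)) := by
  have h (x : ℝ) (n : ℕ) : (descPochhammer ℤ n).smeval x = fallingFactorial x n := by
    rw [fallingFactorial_eq_eval, ← Polynomial.aeval_eq_smeval, Polynomial.aeval_def,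
      ← Polynomial.eval_map, descPochhammer_map]
  have := Ring.descPochhammer_smeval_add k (Commute.all a b)
  simp only [h] at this
  rw [this, Finset.Nat.sum_antidiagonal_eq_sum_range_succ_mk]

/-! ### Binomial sums with a real upper argument -/

lemma realBinom_natCast (M n : ℕ) : realBinom M n = M.choose n := by
  rw [realBinom, fallingFactorial_eq_eval, Nat.cast_choose_eq_descPochhammer_div]

/-- Compare coefficients of X^k in (1 + X)^{2M} = (X(X + 2) + 1)^M; the n-th term of the outer
binomial expansion corresponds to b = k - n. -/
lemma sum_two_pow_mul_choose (M k : ℕ) :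
    ∑ b ∈ Finset.range (k / 2 + 1), 2 ^ (k - 2 * b) * M.choose (k - b) * (k - b).choose b =
      (2 * M).choose k := by
  have h1 : ((1 + Polynomial.X : Polynomial ℕ) ^ (2 * M)).coeff k =
      ∑ n ∈ Finset.range (M + 1), if n ≤ k then
        M.choose n * (2 ^ (n - (k - n)) * n.choose (k - n)) else 0 := by
    rw [pow_mul, show (1 + Polynomial.X : Polynomial ℕ) ^ 2 =
      Polynomial.X * (Polynomial.X + Polynomial.C 2) + 1 by simp; ring, add_pow]
    simp only [Polynomial.finsetSum_coeff, one_pow, mul_one, mul_pow]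
    refine Finset.sum_congr rfl fun n _ => ?_
    rw [mul_assoc, Polynomial.coeff_X_pow_mul', ← Polynomial.C_eq_natCast,
      Polynomial.coeff_mul_C, Polynomial.coeff_X_add_C_pow]
    split_ifs <;> simp; ring
  rw [Polynomial.coeff_one_add_X_pow, Nat.cast_id] at h1
  rw [h1]
  have h2 : ∑ n ∈ Finset.range (M + 1), (if n ≤ k then
        M.choose n * (2 ^ (n - (k - n)) * n.choose (k - n)) else 0) =
      ∑ n ∈ Finset.range (k + 1), M.choose n * (2 ^ (n - (k - n)) * n.choose (k - n)) := by
    rw [← Finset.sum_filter]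
    refine Finset.sum_subset_zero_on_sdiff (fun n hn => ?_) (fun n hn => ?_) (fun _ _ => rfl)
    · simp at hn ⊢; omega
    · simp at hn
      rw [Nat.choose_eq_zero_of_lt (by omega), zero_mul]
  rw [h2, ← Finset.sum_range_reflect _ (k + 1)]
  refine Finset.sum_subset_zero_on_sdiff (fun n hn => ?_) (fun n hn => ?_) (fun b hb => ?_)
  · simp at hn ⊢; omega
  · simp at hn
    rw [show k + 1 - 1 - n = k - n by omega, Nat.choose_eq_zero_of_lt (n := k - n) (by omega)]
    simp
  · simp at hb
    rw [show k + 1 - 1 - b = k - b by omega, show k - (k - b) = b by omega,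
      show k - b - b = k - 2 * b by omega]
    ring

/-- Both sides are polynomials in σ and agree at every natural number. -/
lemma sum_two_pow_mul_realBinom (σ : ℝ) (k : ℕ) :
    ∑ b ∈ Finset.range (k / 2 + 1), 2 ^ (k - 2 * b) * realBinom σ (k - b) * (k - b).choose b =
      realBinom (2 * σ) k := by
  let p : Polynomial ℝ := ∑ b ∈ Finset.range (k / 2 + 1), Polynomial.C (2 ^ (k - 2 * b)) *
    (descPochhammer ℝ (k - b) * Polynomial.C (((k - b)! : ℝ)⁻¹)) *
      Polynomial.C ((k - b).choose b : ℝ)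
  let q : Polynomial ℝ :=
    (descPochhammer ℝ k).comp (Polynomial.C 2 * Polynomial.X) * Polynomial.C ((k ! : ℝ)⁻¹)
  have hp (σ : ℝ) : p.eval σ = ∑ b ∈ Finset.range (k / 2 + 1),
      2 ^ (k - 2 * b) * realBinom σ (k - b) * (k - b).choose b := by
    simp [p, Polynomial.eval_finsetSum, realBinom, fallingFactorial_eq_eval, div_eq_mul_inv]
  have hq (σ : ℝ) : q.eval σ = realBinom (2 * σ) k := by
    simp [q, realBinom, fallingFactorial_eq_eval, div_eq_mul_inv]
  have hpq : p = q := by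
    refine Polynomial.eq_of_infinite_eval_eq _ _ ((Set.infinite_range_of_injective
      (Nat.cast_injective (R := ℝ))).mono ?_)
    rintro _ ⟨M, rfl⟩
    simp only [Set.mem_ofPred_eq, hp, hq]
    have := sum_two_pow_mul_choose M k
    have h2 : (2 * (M : ℝ)) = ((2 * M : ℕ) : ℝ) := by push_cast; ring
    rw [h2]
    simp only [realBinom_natCast]
    exact_mod_cast this
  rw [← hp, hpq, hq]

lemma realBinom_mul_choose_mul_choose (σ : ℝ) (p r l : ℕ) :
    realBinom σ (p + l + r) * (p + l + r).choose (l + r) * (l + r).choose l =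
      realBinom σ l * (realBinom (σ - l) (p + r) * (p + r).choose r) := by
  rw [Nat.cast_choose ℝ (show l + r ≤ p + l + r by omega),
    Nat.cast_choose ℝ (show l ≤ l + r by omega), Nat.cast_choose ℝ (show r ≤ p + r by omega),
    show p + l + r - (l + r) = p by omega, show l + r - l = r by omega,
    show p + r - r = p by omega, realBinom, realBinom, realBinom,
    show p + l + r = l + (p + r) by ring, fallingFactorial_add]
  field_simp

lemma sum_two_pow_mul_realBinom_mul_choose (σ : ℝ) (k l : ℕ) (hl : l ≤ k / 2) :
    ∑ b ∈ Finset.range (k / 2 + 1),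
        2 ^ (k - 2 * b) * realBinom σ (k - b) * (k - b).choose b * b.choose l =
      realBinom σ l * realBinom (2 * σ - 2 * l) (k - 2 * l) := by
  obtain ⟨d, hd⟩ := Nat.exists_eq_add_of_le hl
  have hd' : (k - 2 * l) / 2 = d := by omega
  rw [show 2 * σ - 2 * l = 2 * (σ - l) by ring, ← sum_two_pow_mul_realBinom, hd',
    show k / 2 + 1 = l + (d + 1) by omega, Finset.sum_range_add, Finset.sum_eq_zero, zero_add,
    Finset.mul_sum]
  · refine Finset.sum_congr rfl fun r hr => ?_
    have hr : r ≤ d := Nat.lt_succ_iff.1 (Finset.mem_range.1 hr)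
    obtain ⟨p, hp⟩ : ∃ p, k = p + 2 * (l + r) := ⟨k - 2 * (l + r), by omega⟩
    have := realBinom_mul_choose_mul_choose σ p r l
    rw [show k - 2 * (l + r) = p by omega, show k - (l + r) = p + l + r by omega,
      show k - 2 * l - 2 * r = p by omega, show k - 2 * l - r = p + r by omega]
    linear_combination (2 : ℝ) ^ p * this
  · intro b hb
    rw [Nat.choose_eq_zero_of_lt (Finset.mem_range.1 hb)]
    simp

/-- Chu–Vandermonde: reflection turns the falling factorials with bases moving with l into ones with
the fixed bases -y-1 and b-1-x. -/
lemma sum_choose_mul_fallingFactorial (x y : ℝ) (b : ℕ) :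
    ∑ l ∈ Finset.range (b + 1), (b.choose l : ℝ) *
        (fallingFactorial (y + l) l * fallingFactorial (x - l) (b - l)) =
      fallingFactorial (x + y + 1) b := by
  have h := neg_one_pow_mul_fallingFactorial (b - 2 - x - y) b
  rw [show (b : ℝ) - 1 - (b - 2 - x - y) = x + y + 1 by ring,
    show (b : ℝ) - 2 - x - y = (-y - 1) + (b - 1 - x) by ring, fallingFactorial_add_left] at h
  rw [← h, Finset.mul_sum]
  refine Finset.sum_congr rfl fun l hl => ?_
  have hl : l ≤ b := Nat.lt_succ_iff.1 (Finset.mem_range.1 hl)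
  have h1 := neg_one_pow_mul_fallingFactorial (-y - 1) l
  have h2 := neg_one_pow_mul_fallingFactorial (b - 1 - x) (b - l)
  rw [Nat.cast_sub hl] at h2
  rw [show (y + l : ℝ) = l - 1 - (-y - 1) by ring, ← h1,
    show (x - l : ℝ) = b - l - 1 - (b - 1 - x) by ring, ← h2]
  have : (-1 : ℝ) ^ b = (-1) ^ l * (-1) ^ (b - l) := by rw [← pow_add, Nat.add_sub_cancel' hl]
  rw [this]; ring

/-- The coefficient of `(z·ξ)^{k-2b} |ξ|^{2b}` in `(ξ·∇)^k |z|^s`, for `|z| = 1`. -/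
def radialCoeff (s : ℝ) (k b : ℕ) : ℝ :=
  (k ! : ℝ) * 2 ^ (k - 2 * b) * realBinom (s / 2) (k - b) * (k - b).choose b

/-- The factor in `Δ^b |z|^s = lapFactor N s b * |z|^{s-2b}`. -/
def lapFactor (N : ℕ) (s : ℝ) (b : ℕ) : ℝ :=
  ∏ i ∈ Finset.range b, (s - 2 * i) * (s - 2 * i + N - 2)

lemma lapFactor_eq (N : ℕ) (s : ℝ) (b : ℕ) :
    lapFactor N s b =
      4 ^ b * fallingFactorial (s / 2) b * fallingFactorial (s / 2 + N / 2 - 1) b := by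
  induction b with
  | zero => simp [lapFactor]
  | succ b ih =>
    rw [lapFactor, Finset.prod_range_succ, ← lapFactor, ih, fallingFactorial_succ,
      fallingFactorial_succ]
    ring

/-- Isolates the dependence on N in the factor ((N-3)/2 + l)_l. Vandermonde is applied to (s-1)/2 +
(N-3)/2 + 1, and the duplication formula for (s-2l)_{2p} reassembles the remaining half-step
products. -/
lemma lapFactor_mul_fallingFactorial (N : ℕ) (s : ℝ) (k b : ℕ) (hb : 2 * b ≤ k) :
    lapFactor N s b * fallingFactorial (s - 2 * b) (k - 2 * b) =
      ∑ l ∈ Finset.range (b + 1), (b.choose l : ℝ) * (4 ^ l *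
        fallingFactorial (((N : ℝ) - 3) / 2 + l) l * fallingFactorial (s / 2) l *
          fallingFactorial (s - 2 * l) (k - 2 * l)) := by
  have h := sum_choose_mul_fallingFactorial ((s - 1) / 2) (((N : ℝ) - 3) / 2) b
  rw [lapFactor_eq, show s / 2 + N / 2 - 1 = (s - 1) / 2 + ((N : ℝ) - 3) / 2 + 1 by ring, ← h,
    Finset.mul_sum, Finset.sum_mul]
  refine Finset.sum_congr rfl fun l hl => ?_
  obtain ⟨p, rfl⟩ := Nat.exists_eq_add_of_le (Nat.lt_succ_iff.1 (Finset.mem_range.1 hl))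
  rw [show k - 2 * l = 2 * p + (k - 2 * (l + p)) by omega, fallingFactorial_add _ (2 * p),
    fallingFactorial_two_mul, fallingFactorial_add (s / 2) l p, show l + p - l = p by omega,
    show (s - 2 * l - 1) / 2 = (s - 1) / 2 - l by ring, show (s - 2 * l) / 2 = s / 2 - l by ring,
    pow_add]
  push_cast
  rw [show s - 2 * (l : ℝ) - 2 * p = s - 2 * (l + p) by ring]
  ring

lemma lam_inner_sum (s : ℝ) (k l : ℕ) (hl : l ≤ k / 2) :
    ∑ n ∈ Finset.Icc ((k + 1) / 2) (k - l), (2 : ℝ) ^ (2 * n - k + l) * realBinom (s / 2) n *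
          (n.choose (k - n) : ℝ) * ((k - n).choose l : ℝ) =
      2 ^ l * (realBinom (s / 2) l * realBinom (s - 2 * l) (k - 2 * l)) := by
  have h := sum_two_pow_mul_realBinom_mul_choose (s / 2) k l hl
  rw [show 2 * (s / 2) - 2 * l = s - 2 * l by ring] at h
  rw [← h, Finset.mul_sum]
  have h1 : ∑ b ∈ Finset.range (k / 2 + 1), (2 : ℝ) ^ l * (2 ^ (k - 2 * b) *
      realBinom (s / 2) (k - b) * (k - b).choose b * b.choose l) =
      ∑ b ∈ Finset.Icc l (k / 2), (2 : ℝ) ^ l * (2 ^ (k - 2 * b) *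
      realBinom (s / 2) (k - b) * (k - b).choose b * b.choose l) := by
    symm
    refine Finset.sum_subset_zero_on_sdiff (fun n hn => ?_) (fun n hn => ?_) (fun _ _ => rfl)
    · simp at hn ⊢; omega
    · simp at hn
      rw [Nat.choose_eq_zero_of_lt (n := n) (by omega)]; simp
  rw [h1]
  refine Finset.sum_nbij' (fun n => k - n) (fun b => k - b) ?_ ?_ ?_ ?_ ?_
  · intro n hn; simp at hn ⊢; omega
  · intro n hn; simp at hn ⊢; omega
  · intro n hn; simp at hn ⊢; omega
  · intro n hn; simp at hn ⊢; omega
  · intro n hn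
    simp at hn
    rw [show k - (k - n) = n by omega, show k - 2 * (k - n) = 2 * n - k by omega, pow_add]
    ring

lemma lam_eq_sum_sq (N : ℕ) (s : ℝ) (k : ℕ) :
    lam N s k = (k ! : ℝ) * ∑ l ∈ Finset.range (k / 2 + 1),
      ((k - 2 * l)! : ℝ) * (l ! : ℝ) * fallingFactorial (((N : ℝ) - 3) / 2 + (l : ℝ)) l *
      (2 ^ l * (realBinom (s / 2) l * realBinom (s - 2 * l) (k - 2 * l))) ^ 2 := by
  rw [lam, Finset.range_eq_Ico, Finset.Ico_add_one_right_eq_Icc]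
  congr 1
  refine Finset.sum_congr rfl fun l hl => ?_
  rw [lam_inner_sum s k l (Finset.mem_Icc.1 hl).2]

/-- After exchanging the sums, the b-sum at fixed l evaluates to k! times binom(s/2, l) binom(s-2l,
k-2l). The factors left outside contain the same product up to factorials, which is why λ is a sum
of squares. -/
theorem sum_radialCoeff_mul_eq_lam (N : ℕ) (s : ℝ) (k : ℕ) :
    ∑ b ∈ Finset.range (k / 2 + 1),
      radialCoeff s k b * (lapFactor N s b * fallingFactorial (s - 2 * b) (k - 2 * b)) =
    lam N s k := by
  rw [lam_eq_sum_sq]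
  have h1 : ∀ b ∈ Finset.range (k / 2 + 1), radialCoeff s k b *
      (lapFactor N s b * fallingFactorial (s - 2 * b) (k - 2 * b)) =
      ∑ l ∈ Finset.range (k / 2 + 1), radialCoeff s k b * ((b.choose l : ℝ) * (4 ^ l *
        fallingFactorial (((N : ℝ) - 3) / 2 + l) l * fallingFactorial (s / 2) l *
          fallingFactorial (s - 2 * l) (k - 2 * l))) := by
    intro b hb
    simp at hb
    rw [lapFactor_mul_fallingFactorial _ _ _ _ (by omega), Finset.mul_sum]
    refine Finset.sum_subset_zero_on_sdiff (fun n hn => ?_) (fun n hn => ?_) (fun _ _ => rfl)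
    · simp at hn ⊢; omega
    · simp at hn
      rw [Nat.choose_eq_zero_of_lt (n := b) (by omega)]; simp
  rw [Finset.sum_congr rfl h1, Finset.sum_comm, Finset.mul_sum]
  refine Finset.sum_congr rfl fun l hl => ?_
  have hl : l ≤ k / 2 := Nat.lt_succ_iff.1 (Finset.mem_range.1 hl)
  have h2 := sum_two_pow_mul_realBinom_mul_choose (s / 2) k l hl
  rw [show 2 * (s / 2) - 2 * l = s - 2 * l by ring] at h2
  have h3 : ∑ b ∈ Finset.range (k / 2 + 1), radialCoeff s k b * (b.choose l : ℝ) =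
      k ! * (realBinom (s / 2) l * realBinom (s - 2 * l) (k - 2 * l)) := by
    rw [← h2, Finset.mul_sum]
    refine Finset.sum_congr rfl fun b _ => ?_
    rw [radialCoeff]; ring
  simp only [← mul_assoc] at h3 ⊢
  simp only [← Finset.sum_mul]
  rw [h3]
  have e1 : fallingFactorial (s / 2) l = realBinom (s / 2) l * (l ! : ℝ) := by
    rw [realBinom]; field_simp
  have e2 : fallingFactorial (s - 2 * l) (k - 2 * l) =
      realBinom (s - 2 * l) (k - 2 * l) * ((k - 2 * l)! : ℝ) := by
    rw [realBinom]; field_simp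
  rw [e1, e2, show (4 : ℝ) ^ l = 2 ^ l * 2 ^ l by rw [← mul_pow]; norm_num]
  ring

/-- N ≥ 3 makes every ((N-3)/2 + l)_l nonnegative, so all terms are nonnegative; the l = 0 term is a
positive multiple of binom(s, k)², nonzero because s < 0. -/
theorem lam_pos (N : ℕ) (hN : 3 ≤ N) (s : ℝ) (hs : s < 0) (k : ℕ) : 0 < lam N s k := by
  have hN' : (3 : ℝ) ≤ N := by exact_mod_cast hN
  rw [lam_eq_sum_sq]
  refine mul_pos (by positivity) (Finset.sum_pos' (fun l _ => ?_) ⟨0, by simp, ?_⟩)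
  · refine mul_nonneg (mul_nonneg (by positivity) ?_) (sq_nonneg _)
    refine Finset.prod_nonneg fun j hj => ?_
    have : (j : ℝ) + 1 ≤ l := by exact_mod_cast Finset.mem_range.1 hj
    linarith
  · have h : realBinom s k ≠ 0 := by
      refine div_ne_zero (Finset.prod_ne_zero_iff.2 fun j _ => ?_) (by positivity)
      have : (0 : ℝ) ≤ j := by positivity
      linarith
    simp only [mul_zero, Nat.sub_zero, Nat.factorial_zero, Nat.cast_one, mul_one,
      fallingFactorial_zero, pow_zero, one_mul, Nat.cast_zero, sub_zero]
    have h0 : realBinom (s / 2) 0 = 1 := by simp [realBinom]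
    rw [h0, one_mul]
    positivity

end PotentialEstimate

end

noncomputable section

namespace PotentialEstimate

/-! ### Constant-coefficient differential operators on functions smooth off the origin -/

open scoped RealInnerProductSpace

variable {N : ℕ}

/-- Real functions on `ℝ^N` that are smooth off the origin, normalized to vanish at the origin. -/
def puncturedSmooth (N : ℕ) : Submodule ℝ (EuclideanSpace ℝ (Fin N) → ℝ) where
  carrier := {f | ContDiffOn ℝ ∞ f {0}ᶜ ∧ f 0 = 0}
  add_mem' hf hg := ⟨hf.1.add hg.1, by simp [hf.2, hg.2]⟩
  zero_mem' := ⟨contDiffOn_const, rfl⟩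
  smul_mem' c f hf := ⟨hf.1.const_smul c, by simp [hf.2]⟩

lemma puncturedSmooth.contDiffAt (f : puncturedSmooth N) {y : EuclideanSpace ℝ (Fin N)}
    (hy : y ≠ 0) : ContDiffAt ℝ ∞ f.1 y :=
  f.2.1.contDiffAt (isOpen_compl_singleton.mem_nhds hy)

lemma puncturedSmooth.differentiableAt (f : puncturedSmooth N) {y : EuclideanSpace ℝ (Fin N)}
    (hy : y ≠ 0) : DifferentiableAt ℝ f.1 y :=
  (puncturedSmooth.contDiffAt f hy).differentiableAt (by simp)

@[ext] lemma puncturedSmooth.ext {f g : puncturedSmooth N}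
    (h : ∀ y, y ≠ 0 → f.1 y = g.1 y) : f = g := by
  refine Subtype.ext (funext fun y => ?_)
  rcases eq_or_ne y 0 with rfl | hy
  · rw [f.2.2, g.2.2]
  · exact h y hy

/-- The directional derivative as an operator on functions smooth off the origin. -/
def dirDeriv (v : EuclideanSpace ℝ (Fin N)) : Module.End ℝ (puncturedSmooth N) where
  toFun f := ⟨fun y => if y = 0 then 0 else fderiv ℝ f.1 y v, by
    refine ⟨?_, by simp⟩
    have : ContDiffOn ℝ ∞ (fun y => fderiv ℝ f.1 y v) {0}ᶜ :=
      (f.2.1.fderiv_of_isOpen isOpen_compl_singleton (by simp)).clm_apply contDiffOn_const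
    exact this.congr fun y hy => if_neg hy⟩
  map_add' f g := by
    ext y hy
    simp [hy, fderiv_add (puncturedSmooth.differentiableAt f hy)
      (puncturedSmooth.differentiableAt g hy)]
  map_smul' c f := by
    ext y hy
    simp [hy, fderiv_const_smul (puncturedSmooth.differentiableAt f hy)]

lemma dirDeriv_apply (v : EuclideanSpace ℝ (Fin N)) (f : puncturedSmooth N)
    {y : EuclideanSpace ℝ (Fin N)} (hy : y ≠ 0) : (dirDeriv v f).1 y = fderiv ℝ f.1 y v :=
  if_neg hy

/-- Symmetry of second derivatives; this is what lets polynomials act as differential operators. -/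
lemma dirDeriv_mul_comm (v w : EuclideanSpace ℝ (Fin N)) :
    dirDeriv v * dirDeriv w = dirDeriv w * dirDeriv v := by
  have key (v w : EuclideanSpace ℝ (Fin N)) (f : puncturedSmooth N)
      (y : EuclideanSpace ℝ (Fin N)) (hy : y ≠ 0) :
      (dirDeriv v (dirDeriv w f)).1 y = fderiv ℝ (fderiv ℝ f.1) y v w := by
    rw [dirDeriv_apply _ _ hy]
    have h1 : (dirDeriv w f).1 =ᶠ[nhds y] fun y => fderiv ℝ f.1 y w := by
      filter_upwards [isOpen_compl_singleton.mem_nhds hy] with x hx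
      exact dirDeriv_apply _ _ hx
    have h2 : DifferentiableAt ℝ (fderiv ℝ f.1) y :=
      ((puncturedSmooth.contDiffAt f hy).fderiv_right (m := 1) (by norm_cast)).differentiableAt (by simp)
    rw [h1.fderiv_eq, fderiv_clm_apply h2 (differentiableAt_const _)]
    simp
  refine LinearMap.ext fun f => ?_
  ext y hy
  rw [Module.End.mul_apply, Module.End.mul_apply, key _ _ _ _ hy, key _ _ _ _ hy]
  exact (((puncturedSmooth.contDiffAt f hy).of_le (m := 2)
    (by norm_cast)).isSymmSndFDerivAt (by simp)).eq v w

-- Polynomial evaluation needs a commutative target, so it is performed in the subalgebra generated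
-- by the commuting family and then included in A.
open scoped IsMulCommutative in
lemma exists_algHom_mvPolynomial {A σ : Type*} [Ring A] [Algebra ℝ A] (a : σ → A)
    (h : ∀ i j, a i * a j = a j * a i) :
    ∃ F : MvPolynomial σ ℝ →ₐ[ℝ] A, ∀ i, F (MvPolynomial.X i) = a i := by
  have : IsMulCommutative (Algebra.adjoin ℝ (Set.range a)) :=
    Algebra.isMulCommutative_adjoin ℝ (by
      rintro _ ⟨v, rfl⟩ _ ⟨w, rfl⟩
      exact h v w)
  let g : σ → Algebra.adjoin ℝ (Set.range a) := fun i => ⟨a i, Algebra.subset_adjoin ⟨i, rfl⟩⟩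
  refine ⟨(Algebra.adjoin ℝ (Set.range a)).val.comp (MvPolynomial.aeval g), fun i => ?_⟩
  simp [g]

/-- The action of a polynomial `P` as the differential operator `P(∂)`. -/
def diffAction (N : ℕ) :
    MvPolynomial (Fin N) ℝ →ₐ[ℝ] Module.End ℝ (puncturedSmooth N) :=
  (exists_algHom_mvPolynomial (fun i : Fin N => dirDeriv (EuclideanSpace.single i (1 : ℝ)))
    fun _ _ => dirDeriv_mul_comm _ _).choose

lemma diffAction_X (i : Fin N) :
    diffAction N (MvPolynomial.X i) = dirDeriv (EuclideanSpace.single i 1) :=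
  (exists_algHom_mvPolynomial (fun i : Fin N => dirDeriv (EuclideanSpace.single i (1 : ℝ)))
    fun _ _ => dirDeriv_mul_comm _ _).choose_spec i

lemma euclidean_sum_single (ξ : EuclideanSpace ℝ (Fin N)) :
    ∑ i, ξ i • EuclideanSpace.single i (1 : ℝ) = ξ := by
  ext j
  simp [Finset.sum_apply, Pi.single_apply]

lemma diffAction_sum_X (ξ : EuclideanSpace ℝ (Fin N)) :
    diffAction N (∑ i, MvPolynomial.C (ξ i) * MvPolynomial.X i) = dirDeriv ξ := by
  refine LinearMap.ext fun f => ?_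
  ext y hy
  have h : ∀ i, diffAction N (MvPolynomial.C (ξ i) * MvPolynomial.X i) =
      ξ i • dirDeriv (EuclideanSpace.single i 1) := fun i => by
    rw [← MvPolynomial.smul_eq_C_mul, map_smul, diffAction_X]
  rw [map_sum, Finset.sum_congr rfl fun i _ => h i, dirDeriv_apply _ _ hy]
  conv_rhs => rw [← euclidean_sum_single ξ, map_sum]
  simp [Finset.sum_apply, dirDeriv_apply _ _ hy]

/-! ### Powers of the norm -/

/-- `|x|^s` as a function smooth off the origin. -/
def normRpow (N : ℕ) (s : ℝ) : puncturedSmooth N :=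
  ⟨fun y => if y = 0 then 0 else ‖y‖ ^ s, by
    refine ⟨?_, by simp⟩
    have : ContDiffOn ℝ ∞ (fun y : EuclideanSpace ℝ (Fin N) => ‖y‖ ^ s) {0}ᶜ := fun y hy =>
      ((contDiffAt_norm ℝ hy).rpow_const_of_ne (norm_ne_zero_iff.2 hy)).contDiffWithinAt
    exact this.congr fun y hy => if_neg hy⟩

lemma normRpow_apply (s : ℝ) {y : EuclideanSpace ℝ (Fin N)} (hy : y ≠ 0) :
    (normRpow N s).1 y = ‖y‖ ^ s := if_neg hy

lemma hasFDerivAt_norm_rpow_of_ne {F : Type*} [NormedAddCommGroup F] [InnerProductSpace ℝ F]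
    (s : ℝ) {y : F} (hy : y ≠ 0) :
    HasFDerivAt (fun y : F => ‖y‖ ^ s) ((s * ‖y‖ ^ (s - 2)) • innerSL ℝ y) y := by
  have hy0 : 0 < ‖y‖ := norm_pos_iff.2 hy
  have h := (hasStrictFDerivAt_norm_sq y).hasFDerivAt.rpow_const (p := s / 2)
    (Or.inl (by positivity))
  have e (r : ℝ) (x : F) : (‖x‖ ^ 2) ^ r = ‖x‖ ^ (2 * r) := by
    rw [← Real.rpow_natCast_mul (norm_nonneg x)]; norm_num
  have h2 := h.congr_of_eventuallyEq (f₁ := fun y : F => ‖y‖ ^ s)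
    (Filter.Eventually.of_forall fun x => by simp only [e]; ring_nf)
  convert h2 using 1
  rw [e]
  ext v
  simp
  ring_nf

/-! ### The expansion of (ξ·∇)^k |x|^s -/

lemma radialCoeff_eq_zero (s : ℝ) {k b : ℕ} (h : k < 2 * b) : radialCoeff s k b = 0 := by
  rw [radialCoeff, Nat.choose_eq_zero_of_lt (by omega)]; simp

lemma radialCoeff_two_mul_add (s : ℝ) (b p : ℕ) :
    radialCoeff s (2 * b + p) b =
      (2 * b + p)! * 2 ^ p * fallingFactorial (s / 2) (b + p) / (b ! * p !) := by
  rw [radialCoeff, realBinom, show 2 * b + p - b = b + p by omega,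
    Nat.cast_choose ℝ (show b ≤ b + p by omega), show 2 * b + p - 2 * b = p by omega,
    show b + p - b = p by omega]
  field_simp

lemma radialCoeff_succ_zero (s : ℝ) (k : ℕ) :
    radialCoeff s (k + 1) 0 = radialCoeff s k 0 * (s - 2 * k) := by
  have h1 := radialCoeff_two_mul_add s 0 (k + 1)
  have h2 := radialCoeff_two_mul_add s 0 k
  simp only [mul_zero, zero_add, Nat.factorial_zero, Nat.cast_one, one_mul] at h1 h2
  rw [h1, h2, fallingFactorial_succ]
  field_simp
  ring

/-- The recursion imposed by one more derivative along ξ: the first summand comes from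
differentiating the power of |x|, the second from differentiating ⟨x, ξ⟩^{k-2b}. -/
lemma radialCoeff_succ_succ (s : ℝ) (k b : ℕ) :
    radialCoeff s (k + 1) (b + 1) = radialCoeff s k (b + 1) * (s - 2 * (k - (b + 1))) +
      radialCoeff s k b * ((k - 2 * b : ℕ) : ℝ) := by
  rcases lt_or_ge k (2 * b) with h | h
  · rw [radialCoeff_eq_zero _ (by omega), radialCoeff_eq_zero _ (by omega),
      radialCoeff_eq_zero _ (by omega)]; simp
  obtain ⟨p, rfl⟩ := Nat.exists_eq_add_of_le h
  rw [show 2 * b + p - 2 * b = p by omega]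
  match p with
  | 0 =>
    rw [radialCoeff_eq_zero _ (by omega), radialCoeff_eq_zero _ (by omega)]; simp
  | 1 =>
    rw [radialCoeff_eq_zero s (k := 2 * b + 1) (b := b + 1) (by omega),
      show 2 * b + 1 + 1 = 2 * (b + 1) + 0 by ring, radialCoeff_two_mul_add,
      radialCoeff_two_mul_add, show 2 * (b + 1) + 0 = (2 * b + 1) + 1 by ring,
      Nat.factorial_succ (2 * b + 1), Nat.factorial_succ b]
    simp only [add_zero]
    push_cast
    field_simp
    simp
    ring
  | q + 2 =>
    have h1 := radialCoeff_two_mul_add s (b + 1) (q + 1)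
    have h2 := radialCoeff_two_mul_add s (b + 1) q
    have h3 := radialCoeff_two_mul_add s b (q + 2)
    rw [show 2 * (b + 1) + (q + 1) = 2 * b + (q + 2) + 1 by ring] at h1
    rw [show 2 * (b + 1) + q = 2 * b + (q + 2) by ring] at h2
    rw [h1, h2, h3, show b + 1 + (q + 1) = b + 1 + q + 1 by ring,
      show b + (q + 2) = b + 1 + q + 1 by ring, fallingFactorial_succ,
      Nat.factorial_succ (2 * b + (q + 2)), Nat.factorial_succ b, Nat.factorial_succ (q + 1),
      Nat.factorial_succ q]
    push_cast
    field_simp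
    ring

lemma sum_radialCoeff (s : ℝ) (k : ℕ) :
    ∑ b ∈ Finset.range (k + 1), radialCoeff s k b = fallingFactorial s k := by
  have h := sum_two_pow_mul_realBinom (s / 2) k
  rw [show 2 * (s / 2) = s by ring] at h
  have h2 : fallingFactorial s k = k ! * realBinom s k := by rw [realBinom]; field_simp
  rw [h2, ← h, Finset.mul_sum]
  symm
  refine Finset.sum_subset_zero_on_sdiff (fun n hn => ?_) (fun n hn => ?_) (fun n _ => ?_)
  · simp at hn ⊢; omega
  · simp at hn
    exact radialCoeff_eq_zero _ (by omega)
  · rw [radialCoeff]; ring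

lemma dirDeriv_pow_normRpow (s : ℝ) (ξ : EuclideanSpace ℝ (Fin N)) (k : ℕ)
    {x : EuclideanSpace ℝ (Fin N)} (hx : x ≠ 0) :
    ((dirDeriv ξ ^ k) (normRpow N s)).1 x = ∑ b ∈ Finset.range (k + 1), radialCoeff s k b *
      ‖x‖ ^ (s - 2 * (k - b)) * (⟪x, ξ⟫ ^ (k - 2 * b) * (‖ξ‖ ^ 2) ^ b) := by
  induction k generalizing x with
  | zero => simp [normRpow_apply s hx, radialCoeff, realBinom]
  | succ k ih =>
    rw [pow_succ', Module.End.mul_apply, dirDeriv_apply _ _ hx]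
    have h1 : ((dirDeriv ξ ^ k) (normRpow N s)).1 =ᶠ[nhds x] fun x =>
        ∑ b ∈ Finset.range (k + 1), radialCoeff s k b *
      ‖x‖ ^ (s - 2 * (k - b)) * (⟪x, ξ⟫ ^ (k - 2 * b) * (‖ξ‖ ^ 2) ^ b) := by
      filter_upwards [isOpen_compl_singleton.mem_nhds hx] with y hy
      exact ih hy
    have h2 (b : ℕ) : ∃ D : EuclideanSpace ℝ (Fin N) →L[ℝ] ℝ, HasFDerivAt (fun x : EuclideanSpace ℝ (Fin N) => radialCoeff s k b *
        ‖x‖ ^ (s - 2 * (k - b)) * (⟪x, ξ⟫ ^ (k - 2 * b) * (‖ξ‖ ^ 2) ^ b)) D x ∧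
        D ξ = radialCoeff s k b * (s - 2 * (k - b)) *
          ‖x‖ ^ (s - 2 * (((k + 1 : ℕ) : ℝ) - b)) *
            (⟪x, ξ⟫ ^ (k + 1 - 2 * b) * (‖ξ‖ ^ 2) ^ b) +
          radialCoeff s k b * ((k - 2 * b : ℕ) : ℝ) *
          ‖x‖ ^ (s - 2 * (((k + 1 : ℕ) : ℝ) - ((b + 1 : ℕ) : ℝ))) *
            (⟪x, ξ⟫ ^ (k + 1 - 2 * (b + 1)) * (‖ξ‖ ^ 2) ^ (b + 1)) := by
      refine ⟨_, ((hasFDerivAt_norm_rpow_of_ne (s - 2 * (k - b)) hx).const_mul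
        (radialCoeff s k b)).mul
        ((((hasFDerivAt_id x).inner ℝ (hasFDerivAt_const ξ x)).pow (k - 2 * b)).mul_const
          ((‖ξ‖ ^ 2) ^ b)), ?_⟩
      rcases lt_or_ge k (2 * b) with hb | hb
      · simp [radialCoeff_eq_zero s hb]
      · have e0 : k + 1 - 2 * b = k - 2 * b + 1 := by omega
        have e1 : k + 1 - 2 * (b + 1) = k - 2 * b - 1 := by omega
        have e2 : s - 2 * ((k : ℝ) - b) - 2 = s - 2 * (((k + 1 : ℕ) : ℝ) - b) := by
          push_cast; ring
        have e3 : s - 2 * (((k + 1 : ℕ) : ℝ) - ((b + 1 : ℕ) : ℝ)) = s - 2 * ((k : ℝ) - b) := by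
          push_cast; ring
        rw [e0, e1, e3, ← e2]
        simp
        ring
    choose D hD hDξ using h2
    rw [h1.fderiv_eq, (HasFDerivAt.fun_sum fun b _ => hD b).fderiv, sum_apply,
      Finset.sum_congr rfl fun b _ => hDξ b, Finset.sum_add_distrib,
      Finset.sum_range_succ' _ (k + 1)]
    -- Shift the index of the first family by one to match the second; the extra top term b = k + 1
    -- has zero coefficient.
    have e4 (T : ℕ → ℝ) : ∑ b ∈ Finset.range (k + 1), radialCoeff s k b *
        (s - 2 * ((k : ℝ) - b)) * T b = ∑ b ∈ Finset.range (k + 1), radialCoeff s k (b + 1) *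
        (s - 2 * ((k : ℝ) - (b + 1 : ℕ))) * T (b + 1) + radialCoeff s (k + 1) 0 * T 0 := by
      have h := Finset.sum_range_succ' (fun b : ℕ => radialCoeff s k b *
        (s - 2 * ((k : ℝ) - b)) * T b) (k + 1)
      rw [Finset.sum_range_succ, radialCoeff_eq_zero s (k := k) (b := k + 1) (by omega)] at h
      rw [radialCoeff_succ_zero]
      simpa using h
    have e5 := e4 fun b => ‖x‖ ^ (s - 2 * (((k + 1 : ℕ) : ℝ) - b)) *
            (⟪x, ξ⟫ ^ (k + 1 - 2 * b) * (‖ξ‖ ^ 2) ^ b)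
    simp only [← mul_assoc] at e5 ⊢
    rw [e5, add_right_comm, ← Finset.sum_add_distrib]
    congr 1
    refine Finset.sum_congr rfl fun b _ => ?_
    rw [radialCoeff_succ_succ]
    push_cast
    ring

/-- Euler's relation for a function homogeneous of degree s: at ξ = x all terms carry the same power
of |x| and the coefficients add up to (s)_k. The direction stays frozen at x while differentiating.
-/
lemma dirDeriv_pow_self_normRpow (s : ℝ) (k : ℕ) {x : EuclideanSpace ℝ (Fin N)} (hx : x ≠ 0) :
    ((dirDeriv x ^ k) (normRpow N s)).1 x = fallingFactorial s k * ‖x‖ ^ s := by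
  rw [dirDeriv_pow_normRpow s x k hx, ← sum_radialCoeff, Finset.sum_mul]
  refine Finset.sum_congr rfl fun b _ => ?_
  rcases lt_or_ge k (2 * b) with hb | hb
  · simp [radialCoeff_eq_zero s hb]
  · have hx0 : 0 < ‖x‖ := norm_pos_iff.2 hx
    rw [real_inner_self_eq_norm_sq, ← pow_add, show k - 2 * b + b = k - b by omega, ← pow_mul,
      mul_assoc, ← Real.rpow_natCast, ← Real.rpow_add hx0, Nat.cast_mul, Nat.cast_sub (by omega)]
    congr 2
    push_cast; ring

lemma diffAction_lap_normRpow (s : ℝ) :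
    diffAction N (∑ i, MvPolynomial.X i ^ 2) (normRpow N s) =
      (s * (s + N - 2)) • normRpow N (s - 2) := by
  ext x hx
  have hx0 : 0 < ‖x‖ := norm_pos_iff.2 hx
  rw [map_sum, LinearMap.sum_apply]
  have h : ∀ i : Fin N, ((diffAction N (MvPolynomial.X i ^ 2)) (normRpow N s)).1 x =
      s * (s - 2) * ‖x‖ ^ (s - 4) * (x i) ^ 2 + s * ‖x‖ ^ (s - 2) := fun i => by
    rw [map_pow, diffAction_X, dirDeriv_pow_normRpow _ _ _ hx]
    have h0 : radialCoeff s 2 0 = s * (s - 2) := by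
      rw [radialCoeff_succ_zero, radialCoeff_succ_zero]; simp [radialCoeff, realBinom]
    have h1 : radialCoeff s 2 1 = s := by
      have := radialCoeff_two_mul_add s 1 0
      simp [fallingFactorial_succ] at this
      rw [this]; ring
    simp [Finset.sum_range_succ, h0, h1, radialCoeff_eq_zero s (show 2 < 2 * 2 by norm_num)]
    norm_num [EuclideanSpace.inner_single_right]
  simp only [AddSubmonoidClass.coe_finsetSum, Finset.sum_apply, h, Finset.sum_add_distrib,
    ← Finset.mul_sum]
  rw [← EuclideanSpace.real_norm_sq_eq]
  simp [normRpow_apply _ hx]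
  have : ‖x‖ ^ (s - 4) * ‖x‖ ^ 2 = ‖x‖ ^ (s - 2) := by
    rw [← Real.rpow_natCast, ← Real.rpow_add hx0]; congr 1; push_cast; ring
  linear_combination s * (s - 2) * this

lemma diffAction_lap_pow_normRpow (s : ℝ) (b : ℕ) :
    diffAction N ((∑ i, MvPolynomial.X i ^ 2) ^ b) (normRpow N s) =
      lapFactor N s b • normRpow N (s - 2 * b) := by
  induction b with
  | zero => simp [lapFactor]
  | succ b ih =>
    rw [pow_succ', map_mul, Module.End.mul_apply, ih, map_smul, diffAction_lap_normRpow, smul_smul,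
      lapFactor, lapFactor, Finset.prod_range_succ,
      show s - 2 * ((b + 1 : ℕ) : ℝ) = s - 2 * b - 2 by push_cast; ring]

/-! ### The derivative tensor of a power of the norm -/

/-- The iterated partial derivatives of `|z|^s`. -/
def radialTensor (s : ℝ) {k : ℕ} (z : EuclideanSpace ℝ (Fin N)) (I : Fin k → Fin N) : ℝ :=
  (diffAction N (∏ j, MvPolynomial.X (I j)) (normRpow N s)).1 z

/-- The multinomial expansion of (ξ·∇)^k shows that T has this generating polynomial. -/
lemma sum_radialTensor_mul_prod (s : ℝ) (k : ℕ) {z : EuclideanSpace ℝ (Fin N)} (hz : z ≠ 0)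
    (ξ : EuclideanSpace ℝ (Fin N)) :
    ∑ I : Fin k → Fin N, radialTensor s z I * ∏ j, ξ (I j) =
      ∑ b ∈ Finset.range (k + 1), radialCoeff s k b *
        ‖z‖ ^ (s - 2 * (k - b)) * (⟪z, ξ⟫ ^ (k - 2 * b) * (‖ξ‖ ^ 2) ^ b) := by
  rw [← dirDeriv_pow_normRpow s ξ k hz, ← diffAction_sum_X, ← map_pow, Fintype.sum_pow, map_sum,
    LinearMap.sum_apply]
  simp only [AddSubmonoidClass.coe_finsetSum, Finset.sum_apply]
  refine Finset.sum_congr rfl fun I _ => ?_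
  rw [Finset.prod_mul_distrib, ← map_prod, ← MvPolynomial.smul_eq_C_mul, map_smul]
  simp [radialTensor, mul_comm]

/-- With z frozen in the coefficients, the generating polynomial of T acts on |·|^s and the result
is evaluated at z. One expression of the polynomial gives ∑ T_I²; the other gives powers of the
Laplacian followed by radial derivatives, both explicit on powers of the norm. -/
theorem sum_radialTensor_sq (s : ℝ) (k : ℕ) {z : EuclideanSpace ℝ (Fin N)} (hz : z ≠ 0) :
    ∑ I : Fin k → Fin N, radialTensor s z I ^ 2 = lam N s k * ‖z‖ ^ (2 * (s - k)) := by
  have hz0 : 0 < ‖z‖ := norm_pos_iff.2 hz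
  have hP : ∑ I : Fin k → Fin N, MvPolynomial.C (radialTensor s z I) *
      ∏ j, MvPolynomial.X (I j) = ∑ b ∈ Finset.range (k + 1),
      MvPolynomial.C (radialCoeff s k b * ‖z‖ ^ (s - 2 * (k - b))) *
        ((∑ i, MvPolynomial.C (z i) * MvPolynomial.X i) ^ (k - 2 * b) *
          (∑ i, MvPolynomial.X i ^ 2) ^ b) := by
    -- Over ℝ a polynomial identity may be checked at points, where it is the expansion already
    -- proved.
    refine MvPolynomial.funext fun ξ => ?_
    have h := sum_radialTensor_mul_prod s k hz (WithLp.toLp 2 ξ)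
    simp only [EuclideanSpace.real_norm_sq_eq, PiLp.inner_apply, RCLike.inner_apply,
      conj_trivial] at h
    simp only [map_sum, map_mul, map_prod, map_pow, MvPolynomial.eval_C, MvPolynomial.eval_X]
    rw [h]
    simp only [mul_comm]
  have h1 := congrArg (fun P => (diffAction N P (normRpow N s)).1 z) hP
  simp only [map_sum, LinearMap.sum_apply, ← MvPolynomial.smul_eq_C_mul, map_smul,
    AddSubmonoidClass.coe_finsetSum, Finset.sum_apply, LinearMap.smul_apply,
    Submodule.coe_smul, Pi.smul_apply, smul_eq_mul] at h1
  have h2 : ∑ I : Fin k → Fin N, radialTensor s z I ^ 2 = ∑ I : Fin k → Fin N,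
      radialTensor s z I * (diffAction N (∏ j, MvPolynomial.X (I j)) (normRpow N s)).1 z :=
    Finset.sum_congr rfl fun I _ => by rw [sq]; rfl
  rw [h2, h1, ← sum_radialCoeff_mul_eq_lam, Finset.sum_mul]
  symm
  refine Finset.sum_subset_zero_on_sdiff (fun n hn => ?_) (fun n hn => ?_) (fun b hb => ?_)
  · simp at hn ⊢; omega
  · simp at hn
    rw [radialCoeff_eq_zero _ (by omega)]; simp
  · have hd := diffAction_sum_X z
    simp only [MvPolynomial.smul_eq_C_mul] at hd ⊢
    rw [map_mul, Module.End.mul_apply, diffAction_lap_pow_normRpow, map_smul, map_pow, hd,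
      Submodule.coe_smul, Pi.smul_apply, dirDeriv_pow_self_normRpow _ _ hz, smul_eq_mul]
    have : ‖z‖ ^ (2 * (s - k)) = ‖z‖ ^ (s - 2 * ((k : ℝ) - b)) * ‖z‖ ^ (s - 2 * (b : ℝ)) := by
      rw [← Real.rpow_add hz0]; congr 1; ring
    rw [this]; ring

end PotentialEstimate

end

noncomputable section

namespace PotentialEstimate

open MeasureTheory
open scoped RealInnerProductSpace

variable {N : ℕ}

/-! ### Integrating a partial derivative of a function with a point singularity -/

/-- By Fubini, integrate first along lines parallel to the i-th axis. Since N ≥ 2, almost every such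
line misses the origin, and there an integrable function with integrable derivative has derivative
of integral zero. -/
lemma integral_partial_eq_zero (hN : 2 ≤ N) (i : Fin N) {f f' : EuclideanSpace ℝ (Fin N) → ℂ}
    (hf : Integrable f) (hf' : Integrable f')
    (h : ∀ x, x ≠ 0 → HasLineDerivAt ℝ f (f' x) x (EuclideanSpace.single i 1)) :
    ∫ x, f' x = 0 := by
  obtain ⟨n, rfl⟩ : ∃ n, N = n + 1 + 1 := ⟨N - 2, by omega⟩
  let e := MeasurableEquiv.piFinSuccAbove (fun _ : Fin (n + 1 + 1) => ℝ) i
  have he : MeasurePreserving e.symm :=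
    (volume_preserving_piFinSuccAbove (fun _ : Fin (n + 1 + 1) => ℝ) i).symm _
  have hp : MeasurePreserving (fun p : ℝ × (Fin (n + 1) → ℝ) =>
      (WithLp.toLp 2 (e.symm p) : EuclideanSpace ℝ (Fin (n + 1 + 1)))) :=
    (PiLp.volume_preserving_toLp (Fin (n + 1 + 1))).comp he
  have hemb : MeasurableEmbedding (fun p : ℝ × (Fin (n + 1) → ℝ) =>
      (WithLp.toLp 2 (e.symm p) : EuclideanSpace ℝ (Fin (n + 1 + 1)))) :=
    (MeasurableEquiv.toLp 2 _).measurableEmbedding.comp e.symm.measurableEmbedding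
  rw [← hp.integral_comp hemb]
  have hg := (hp.integrable_comp_emb hemb).2 hf
  have hg' := (hp.integrable_comp_emb hemb).2 hf'
  rw [Measure.volume_eq_prod] at hg hg' ⊢
  have := integral_prod_symm _ hg'
  simp only [Function.comp_def] at this hg hg'
  rw [this]
  refine integral_eq_zero_of_ae ?_
  have hne : ∀ᵐ y : Fin (n + 1) → ℝ, y ≠ 0 := by
    simp [ae_iff]
  filter_upwards [hg.prod_left_ae, hg'.prod_left_ae, hne] with y h1 h2 hy
  refine integral_eq_zero_of_hasDerivAt_of_integrable (fun t => ?_) h2 h1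
  have hes (t : ℝ) (y : Fin (n + 1) → ℝ) : e.symm (t, y) = i.insertNth t y := rfl
  have key (t : ℝ) : (WithLp.toLp 2 (e.symm (t, y)) : EuclideanSpace ℝ (Fin (n + 1 + 1))) =
      WithLp.toLp 2 (e.symm (0, y)) + t • EuclideanSpace.single i 1 := by
    ext j
    refine Fin.succAboveCases i ?_ (fun j => ?_) j
    · simp [hes]
    · simp [hes, Fin.succAbove_ne]
  have hx0 : (WithLp.toLp 2 (e.symm (t, y)) : EuclideanSpace ℝ (Fin (n + 1 + 1))) ≠ 0 := by
    intro h0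
    refine hy (funext fun j => ?_)
    have := congrArg (fun v : EuclideanSpace ℝ (Fin (n + 1 + 1)) => v (i.succAbove j)) h0
    simpa [hes] using this
  have hd := h _ hx0
  rw [HasLineDerivAt] at hd
  have hd2 := hd.scomp_of_eq t ((hasDerivAt_id t).sub_const t) (by simp)
  simp only [one_smul] at hd2
  refine hd2.congr_of_eventuallyEq (Filter.Eventually.of_forall fun r => ?_)
  simp only [Function.comp_def, id]
  congr 1
  rw [key t, key r]
  module

/-! ### Integrability of power weights -/

/-- In polar coordinates, -N < p gives integrability at 0 and p + N < q at infinity. -/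
lemma integrable_norm_rpow_div (hN : 0 < N) {p : ℝ} (hp : -N < p) {q : ℕ} (hq : p + N < q) :
    Integrable fun z : EuclideanSpace ℝ (Fin N) => ‖z‖ ^ p / (1 + ‖z‖) ^ q := by
  have : Nonempty (Fin N) := ⟨⟨0, hN⟩⟩
  rw [integrable_fun_norm_addHaar volume (f := fun r : ℝ => r ^ p / (1 + r) ^ q)]
  simp only [finrank_euclideanSpace, Fintype.card_fin, smul_eq_mul]
  rw [← Set.Ioc_union_Ioi_eq_Ioi zero_le_one, integrableOn_union]
  have hm : Measurable fun r : ℝ => r ^ (N - 1) * (r ^ p / (1 + r) ^ q) := by fun_prop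
  have e1 : ∀ r : ℝ, 0 < r → r ^ (N - 1) * r ^ p = r ^ ((N : ℝ) - 1 + p) := fun r hr => by
    rw [← Real.rpow_natCast, ← Real.rpow_add hr, Nat.cast_sub hN, Nat.cast_one]
  constructor
  · have h := (intervalIntegral.intervalIntegrable_rpow' (a := 0) (b := 1)
      (r := (N : ℝ) - 1 + p) (by linarith)).1
    refine h.mono' hm.aestronglyMeasurable ?_
    refine (ae_restrict_iff' measurableSet_Ioc).2 (Filter.Eventually.of_forall fun r hr => ?_)
    have hr0 : 0 < r := hr.1
    rw [← mul_div_assoc, e1 r hr0, Real.norm_of_nonneg (by positivity)]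
    exact div_le_self (by positivity) (one_le_pow₀ (by linarith))
  · have h := integrableOn_Ioi_rpow_of_lt (a := (N : ℝ) - 1 + p - q) (by linarith) zero_lt_one
    refine h.mono' hm.aestronglyMeasurable ?_
    refine (ae_restrict_iff' measurableSet_Ioi).2 (Filter.Eventually.of_forall fun r hr => ?_)
    have hr0 : 0 < r := zero_lt_one.trans hr
    rw [← mul_div_assoc, e1 r hr0, Real.norm_of_nonneg (by positivity),
      Real.rpow_sub hr0 _ (q : ℝ), Real.rpow_natCast]
    gcongr
    linarith

/-! ### Homogeneous symbols -/

lemma integrable_cexp_mul {f : EuclideanSpace ℝ (Fin N) → ℂ} (hf : Integrable f)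
    (w : EuclideanSpace ℝ (Fin N)) :
    Integrable fun v => Complex.exp (↑(2 * Real.pi * ⟪v, w⟫) * Complex.I) * f v := by
  refine hf.bdd_mul (c := 1) (Continuous.aestronglyMeasurable (by fun_prop)) ?_
  exact Filter.Eventually.of_forall fun v => (Complex.norm_exp_ofReal_mul_I _).le


/-- Functions smooth off the origin and positively homogeneous of degree `d` there. -/
structure IsHomogSymbol (d : ℝ) (h : EuclideanSpace ℝ (Fin N) → ℂ) : Prop where
  smooth : ContDiffOn ℝ ∞ h {0}ᶜ
  homog : ∀ t : ℝ, 0 < t → ∀ x, x ≠ 0 → h (t • x) = (t ^ d : ℝ) • h x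

namespace IsHomogSymbol

variable {d : ℝ} {h : EuclideanSpace ℝ (Fin N) → ℂ}

lemma differentiableAt (hh : IsHomogSymbol d h) {x : EuclideanSpace ℝ (Fin N)} (hx : x ≠ 0) :
    DifferentiableAt ℝ h x :=
  (hh.smooth.contDiffAt (isOpen_compl_singleton.mem_nhds hx)).differentiableAt (by simp)

lemma aestronglyMeasurable (hh : IsHomogSymbol d h) (hN : 0 < N) :
    AEStronglyMeasurable h volume := by
  have : Nonempty (Fin N) := ⟨⟨0, hN⟩⟩
  have := hh.smooth.continuousOn.aestronglyMeasurable (μ := volume)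
    (measurableSet_singleton (0 : EuclideanSpace ℝ (Fin N))).compl
  rwa [Measure.restrict_eq_self_of_ae_mem] at this
  simp [ae_iff]

lemma exists_bound (hh : IsHomogSymbol d h) : ∃ C, 0 ≤ C ∧ ∀ x, x ≠ 0 → ‖h x‖ ≤ C * ‖x‖ ^ d := by
  have hs : ContinuousOn h (Metric.sphere 0 1) :=
    hh.smooth.continuousOn.mono fun x hx => by
      have : ‖x‖ = 1 := by simpa using hx
      rintro rfl
      simp at this
  obtain ⟨C, hC⟩ :=
    (isCompact_sphere (0 : EuclideanSpace ℝ (Fin N)) 1).exists_bound_of_continuousOn hs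
  refine ⟨max C 0, le_max_right _ _, fun x hx => ?_⟩
  have hx0 : 0 < ‖x‖ := norm_pos_iff.2 hx
  have h1 : x = ‖x‖ • (‖x‖⁻¹ • x) := by rw [smul_smul, mul_inv_cancel₀ hx0.ne', one_smul]
  have h2 : ‖‖x‖⁻¹ • x‖ = 1 := by rw [norm_smul, norm_inv, norm_norm, inv_mul_cancel₀ hx0.ne']
  rw [h1, hh.homog _ hx0 _ (by simp [hx]), norm_smul, ← h1, mul_comm,
    Real.norm_of_nonneg (by positivity)]
  gcongr
  exact (hC _ (by simpa using h2)).trans (le_max_left _ _)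

lemma fderiv_apply (hh : IsHomogSymbol d h) (v : EuclideanSpace ℝ (Fin N)) :
    IsHomogSymbol (d - 1) fun x => fderiv ℝ h x v where
  smooth := (hh.smooth.fderiv_of_isOpen isOpen_compl_singleton (by simp)).clm_apply
    contDiffOn_const
  homog t ht x hx := by
    have htx : t • x ≠ 0 := smul_ne_zero ht.ne' hx
    have h1 : HasFDerivAt (fun y => h (t • y)) (t • fderiv ℝ h (t • x)) x := by
      have := (hh.differentiableAt htx).hasFDerivAt.comp x
        ((hasFDerivAt_id x).const_smul t)
      refine this.congr_fderiv ?_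
      ext v; simp
    have h2 : HasFDerivAt (fun y => h (t • y)) ((t ^ d : ℝ) • fderiv ℝ h x) x :=
      ((hh.differentiableAt hx).hasFDerivAt.const_smul (t ^ d)).congr_of_eventuallyEq
        (by filter_upwards [isOpen_compl_singleton.mem_nhds hx] with y hy using hh.homog t ht y hy)
    have h3 := congrArg (fun L : EuclideanSpace ℝ (Fin N) →L[ℝ] ℂ => t⁻¹ • L v) (h1.unique h2)
    simp only [smul_apply, smul_smul, inv_mul_cancel₀ ht.ne', one_smul] at h3
    rw [h3, Real.rpow_sub_one ht.ne', mul_comm, div_eq_mul_inv]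

lemma mul {d' : ℝ} {h' : EuclideanSpace ℝ (Fin N) → ℂ} (hh : IsHomogSymbol d h)
    (hh' : IsHomogSymbol d' h') : IsHomogSymbol (d + d') fun x => h x * h' x where
  smooth := hh.smooth.mul hh'.smooth
  homog t ht x hx := by
    rw [hh.homog t ht x hx, hh'.homog t ht x hx, Real.rpow_add ht]
    simp only [Complex.real_smul]; push_cast; ring

lemma norm_rpow (c d : ℝ) (hc : 0 < c) :
    IsHomogSymbol d fun x : EuclideanSpace ℝ (Fin N) => (((c * ‖x‖) ^ d : ℝ) : ℂ) where
  smooth x hx := (Complex.ofRealCLM.contDiff.contDiffAt.comp x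
    ((contDiffAt_const.mul (contDiffAt_norm ℝ hx)).rpow_const_of_ne
      (mul_ne_zero hc.ne' (norm_ne_zero_iff.2 hx)))).contDiffWithinAt
  homog t ht x hx := by
    rw [norm_smul, Real.norm_of_nonneg ht.le, mul_left_comm, Real.mul_rpow ht.le (by positivity)]
    simp

lemma prod_coord (c : ℂ) {q : ℕ} (I : Fin q → Fin N) :
    IsHomogSymbol (q : ℝ) fun x : EuclideanSpace ℝ (Fin N) => c * ∏ j, ((x (I j) : ℝ) : ℂ) where
  smooth := by
    refine ContDiff.contDiffOn (contDiff_const.mul (contDiff_prod fun j _ => ?_))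
    exact Complex.ofRealCLM.contDiff.comp (by fun_prop)
  homog t ht x hx := by
    simp [Finset.prod_mul_distrib]
    ring

lemma integrable_mul (hh : IsHomogSymbol d h) (hN : 0 < N) (hd : -N < d)
    (g : SchwartzMap (EuclideanSpace ℝ (Fin N)) ℂ) : Integrable fun x => h x * g x := by
  have : Nonempty (Fin N) := ⟨⟨0, hN⟩⟩
  obtain ⟨C, hC0, hC⟩ := hh.exists_bound
  obtain ⟨q, hq⟩ := exists_nat_gt (d + N)
  have hg : ∃ C', 0 ≤ C' ∧ ∀ x, (1 + ‖x‖) ^ q * ‖g x‖ ≤ C' := by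
    refine ⟨_, ?_, fun x => by
      simpa using SchwartzMap.one_add_le_sup_seminorm_apply (𝕜 := ℝ) (m := (q, 0))
        le_rfl le_rfl g x⟩
    positivity
  obtain ⟨C', hC'0, hC'⟩ := hg
  refine ((integrable_norm_rpow_div hN hd hq).const_mul (C * C')).mono'
    ((hh.aestronglyMeasurable hN).mul g.continuous.aestronglyMeasurable) ?_
  have hne : ∀ᵐ y : EuclideanSpace ℝ (Fin N), y ≠ 0 := by simp [ae_iff]
  filter_upwards [hne] with x hx
  rw [norm_mul, mul_div_assoc', le_div_iff₀ (by positivity)]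
  calc ‖h x‖ * ‖g x‖ * (1 + ‖x‖) ^ q = ‖h x‖ * ((1 + ‖x‖) ^ q * ‖g x‖) := by ring
    _ ≤ (C * ‖x‖ ^ d) * C' := by
      gcongr
      · exact hC x hx
      · exact hC' x
    _ = _ := by ring

/-! ### Decay by integration by parts -/

/-- The bound 1 - N < d keeps ∂_i h, of degree d - 1, integrable at the origin, so the singularity
contributes nothing. -/
lemma fourierInv_partial (hh : IsHomogSymbol d h) (hN : 2 ≤ N) (hd : 1 - N < d)
    (g : SchwartzMap (EuclideanSpace ℝ (Fin N)) ℂ) (i : Fin N) (y : EuclideanSpace ℝ (Fin N)) :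
    2 * Real.pi * Complex.I * (y i : ℂ) * 𝓕⁻ (fun x => h x * g x) y =
      - (𝓕⁻ (fun x => fderiv ℝ h x (EuclideanSpace.single i 1) * g x) y +
        𝓕⁻ (fun x => h x * fderiv ℝ g x (EuclideanSpace.single i 1)) y) := by
  simp only [Real.fourierInv_eq', smul_eq_mul]
  have i0 := integrable_cexp_mul (hh.integrable_mul (by omega) (by linarith) g) y
  have i1 := integrable_cexp_mul ((hh.fderiv_apply (EuclideanSpace.single i 1)).integrable_mul
    (by omega) (by linarith) g) y
  have i2 := integrable_cexp_mul (hh.integrable_mul (by omega) (by linarith)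
    (LineDeriv.lineDerivOp (EuclideanSpace.single i (1 : ℝ)) g)) y
  simp only [SchwartzMap.lineDerivOp_apply_eq_fderiv] at i2
  have i3 := i0.const_mul (2 * Real.pi * Complex.I * (y i : ℂ))
  have h0 := integral_partial_eq_zero hN i i0 ((i1.add i2).add i3) fun x hx => ?_
  · rw [integral_add' (i1.add i2) i3, integral_add' i1 i2, integral_const_mul] at h0
    exact eq_neg_of_add_eq_zero_right h0
  · have hd1 : HasFDerivAt (fun v : EuclideanSpace ℝ (Fin N) =>
        (↑(2 * Real.pi * ⟪v, y⟫) : ℂ) * Complex.I) _ x :=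
      (Complex.ofRealCLM.hasFDerivAt.comp x
        (((hasFDerivAt_id x).inner ℝ (hasFDerivAt_const y x)).const_mul (2 * Real.pi))).mul_const
          Complex.I
    have hd := hd1.cexp.mul ((hh.differentiableAt hx).hasFDerivAt.mul
      (g.differentiableAt (x := x)).hasFDerivAt)
    refine (hd.hasLineDerivAt (EuclideanSpace.single i 1)).congr_deriv ?_
    simp [EuclideanSpace.inner_single_left, fderivInnerCLM_apply]
    ring

/-- Each factor y_i costs one derivative, falling on h (degree drops by one) or on g (still
Schwartz). The hypothesis n - N < d pays for n of them. -/
lemma exists_pow_coord_bound (hN : 2 ≤ N) (i : Fin N) (n : ℕ) (hh : IsHomogSymbol d h)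
    (hd : n - N < d) (g : SchwartzMap (EuclideanSpace ℝ (Fin N)) ℂ) :
    ∃ C, ∀ y : EuclideanSpace ℝ (Fin N), |y i| ^ n * ‖𝓕⁻ (fun x => h x * g x) y‖ ≤ C := by
  induction n generalizing d h g with
  | zero =>
    refine ⟨∫ x, ‖h x * g x‖, fun y => ?_⟩
    rw [pow_zero, one_mul, Real.fourierInv_eq']
    refine (norm_integral_le_integral_norm _).trans_eq (integral_congr_ae ?_)
    refine Filter.Eventually.of_forall fun x => ?_
    simp only [smul_eq_mul, norm_mul, Complex.norm_exp_ofReal_mul_I, one_mul]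
  | succ n ih =>
    push_cast at hd
    have hn : (0 : ℝ) ≤ n := by positivity
    obtain ⟨C1, h1⟩ := ih (hh.fderiv_apply (EuclideanSpace.single i 1)) (by linarith) g
    obtain ⟨C2, h2⟩ := ih hh (by linarith)
      (LineDeriv.lineDerivOp (EuclideanSpace.single i (1 : ℝ)) g)
    refine ⟨C1 + C2, fun y => ?_⟩
    have key := congrArg norm (hh.fourierInv_partial hN (by linarith) g i y)
    rw [norm_neg, norm_mul, norm_mul] at key
    have e : ‖(2 * Real.pi * Complex.I : ℂ)‖ = 2 * Real.pi := by
      simp [abs_of_pos Real.pi_pos]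
    have hpi : 1 ≤ 2 * Real.pi := by linarith [Real.pi_gt_three]
    rw [e, Complex.norm_real, Real.norm_eq_abs] at key
    calc |y i| ^ (n + 1) * ‖𝓕⁻ (fun x => h x * g x) y‖
        = 1 * (|y i| ^ n * (|y i| * ‖𝓕⁻ (fun x => h x * g x) y‖)) := by ring
      _ ≤ 2 * Real.pi * (|y i| ^ n * (|y i| * ‖𝓕⁻ (fun x => h x * g x) y‖)) := by gcongr
      _ = |y i| ^ n * (2 * Real.pi * |y i| * ‖𝓕⁻ (fun x => h x * g x) y‖) := by ring
      _ ≤ |y i| ^ n * (_ + _) := by rw [key]; gcongr; exact norm_add_le _ _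
      _ ≤ C1 + C2 := by rw [mul_add]; exact add_le_add (h1 y) (h2 y)

lemma exists_decay (hN : 2 ≤ N) (n : ℕ) (hh : IsHomogSymbol d h)
    (hd : n - N < d) (g : SchwartzMap (EuclideanSpace ℝ (Fin N)) ℂ) :
    ∃ C, 0 ≤ C ∧ ∀ y : EuclideanSpace ℝ (Fin N),
      (1 + ‖y‖) ^ n * ‖𝓕⁻ (fun x => h x * g x) y‖ ≤ C := by
  have hn : (0 : ℝ) ≤ n := by positivity
  obtain ⟨C0, h0⟩ := exists_pow_coord_bound hN ⟨0, by omega⟩ 0 hh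
    (by push_cast; linarith) g
  choose C hC using fun i => exists_pow_coord_bound hN i n hh hd g
  simp only [pow_zero, one_mul] at h0
  have hle (y : EuclideanSpace ℝ (Fin N)) :
      (1 + ‖y‖) ^ n ≤ (N + 1) ^ n * (1 + ∑ i, |y i| ^ n) := by
    have h1 : ‖y‖ ≤ ∑ i, |y i| := by
      conv_lhs => rw [← euclidean_sum_single y]
      refine (norm_sum_le _ _).trans (Finset.sum_le_sum fun i _ => ?_)
      simp [norm_smul]
    have : Nonempty (Fin N) := ⟨⟨0, by omega⟩⟩
    obtain ⟨i, hi⟩ := Finite.exists_max fun i => |y i|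
    have h2 : ∑ j, |y j| ≤ N * |y i| := by
      refine (Finset.sum_le_card_nsmul _ _ _ fun j _ => hi j).trans_eq ?_
      simp
    have h3 : 1 + ‖y‖ ≤ (N + 1) * max 1 |y i| := by
      have a1 := le_max_left 1 |y i|
      have a2 := mul_le_mul_of_nonneg_left (le_max_right 1 |y i|) (Nat.cast_nonneg (α := ℝ) N)
      linarith
    refine (pow_le_pow_left₀ (by positivity) h3 n).trans ?_
    rw [mul_pow]
    gcongr
    have h4 : |y i| ^ n ≤ ∑ i, |y i| ^ n :=
      Finset.single_le_sum (f := fun i => |y i| ^ n) (fun j _ => by positivity) (Finset.mem_univ i)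
    rcases max_cases 1 |y i| with ⟨h, _⟩ | ⟨h, _⟩
    · rw [h, one_pow]
      have : 0 ≤ ∑ i, |y i| ^ n := Finset.sum_nonneg fun j _ => by positivity
      linarith
    · rw [h]; linarith
  refine ⟨max 0 ((N + 1) ^ n * (C0 + ∑ i, C i)), le_max_left _ _, fun y => ?_⟩
  refine le_trans ?_ (le_max_right _ _)
  calc _ ≤ (N + 1) ^ n * (1 + ∑ i, |y i| ^ n) * ‖𝓕⁻ (fun x => h x * g x) y‖ := by
        gcongr; exact hle y
    _ = (N + 1) ^ n * (‖𝓕⁻ (fun x => h x * g x) y‖ +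
        ∑ i, |y i| ^ n * ‖𝓕⁻ (fun x => h x * g x) y‖) := by rw [← Finset.sum_mul]; ring
    _ ≤ _ := by
      gcongr with i
      · exact h0 y
      · exact hC i y

end IsHomogSymbol

end PotentialEstimate

end

noncomputable section

namespace PotentialEstimate

open MeasureTheory
open scoped RealInnerProductSpace

variable {N : ℕ}

/-! ### Decay of fractional derivatives of Schwartz functions -/

/-- The inverse Fourier transform of `(2π|ξ|)^a g(ξ)`. -/
def fracMul (a : ℝ) (g : SchwartzMap (EuclideanSpace ℝ (Fin N)) ℂ) :
    EuclideanSpace ℝ (Fin N) → ℂ :=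
  𝓕⁻ (fun ξ : EuclideanSpace ℝ (Fin N) => (((2 * Real.pi * ‖ξ‖) ^ a : ℝ) : ℂ) * g ξ)

lemma integrable_fracMul_symbol (hN : 0 < N) {a : ℝ} (ha : -N < a)
    (g : SchwartzMap (EuclideanSpace ℝ (Fin N)) ℂ) :
    Integrable fun ξ : EuclideanSpace ℝ (Fin N) =>
      (((2 * Real.pi * ‖ξ‖) ^ a : ℝ) : ℂ) * g ξ :=
  (IsHomogSymbol.norm_rpow (2 * Real.pi) a (by positivity)).integrable_mul hN ha g

lemma integrable_pow_mul_fracMul_symbol (hN : 0 < N) {a : ℝ} (ha : -N < a)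
    (g : SchwartzMap (EuclideanSpace ℝ (Fin N)) ℂ) (n : ℕ) :
    Integrable fun ξ : EuclideanSpace ℝ (Fin N) =>
      ‖ξ‖ ^ n * ‖(((2 * Real.pi * ‖ξ‖) ^ a : ℝ) : ℂ) * g ξ‖ := by
  have hn : (0 : ℝ) ≤ n := by positivity
  have h := (((IsHomogSymbol.norm_rpow 1 (n : ℝ) one_pos).mul
    (IsHomogSymbol.norm_rpow (2 * Real.pi) a (by positivity))).integrable_mul hN
      (by linarith) g).norm
  refine h.congr (Filter.Eventually.of_forall fun ξ => ?_)
  simp only [one_mul, Real.rpow_natCast, norm_mul, Complex.norm_real, norm_pow, norm_norm]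
  ring

lemma integrable_pow_mul_comp_neg (hN : 0 < N) {a : ℝ} (ha : -N < a)
    (g : SchwartzMap (EuclideanSpace ℝ (Fin N)) ℂ) (n : ℕ) :
    Integrable fun ξ : EuclideanSpace ℝ (Fin N) =>
      ‖ξ‖ ^ n * ‖(((2 * Real.pi * ‖-ξ‖) ^ a : ℝ) : ℂ) * g (-ξ)‖ := by
  have h := (integrable_pow_mul_fracMul_symbol hN ha g n).comp_neg
  simpa only [norm_neg] using h

lemma fracMul_eq_fourier (a : ℝ) (g : SchwartzMap (EuclideanSpace ℝ (Fin N)) ℂ) :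
    fracMul a g = 𝓕 (fun ξ : EuclideanSpace ℝ (Fin N) =>
      (((2 * Real.pi * ‖-ξ‖) ^ a : ℝ) : ℂ) * g (-ξ)) :=
  Real.fourierInv_eq_fourier_comp_neg _

lemma contDiff_fracMul (hN : 0 < N) {a : ℝ} (ha : -N < a)
    (g : SchwartzMap (EuclideanSpace ℝ (Fin N)) ℂ) : ContDiff ℝ ∞ (fracMul a g) := by
  rw [fracMul_eq_fourier]
  exact Real.contDiff_fourier (N := ⊤) fun n _ => integrable_pow_mul_comp_neg hN ha g n

lemma iteratedFDeriv_fracMul_apply (hN : 0 < N) {a : ℝ} (ha : -N < a)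
    (g : SchwartzMap (EuclideanSpace ℝ (Fin N)) ℂ) (j : ℕ) (y : EuclideanSpace ℝ (Fin N))
    (m : Fin j → EuclideanSpace ℝ (Fin N)) :
    iteratedFDeriv ℝ j (fracMul a g) y m = 𝓕⁻ (fun ξ : EuclideanSpace ℝ (Fin N) =>
      ((2 * Real.pi * Complex.I) ^ j * ∏ l, ((⟪ξ, m l⟫ : ℝ) : ℂ)) *
        ((((2 * Real.pi * ‖ξ‖) ^ a : ℝ) : ℂ) * g ξ)) y := by
  have hmeas : AEStronglyMeasurable (fun ξ : EuclideanSpace ℝ (Fin N) =>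
      (((2 * Real.pi * ‖-ξ‖) ^ a : ℝ) : ℂ) * g (-ξ)) :=
    (integrable_fracMul_symbol hN ha g).comp_neg.aestronglyMeasurable
  rw [fracMul_eq_fourier, Real.iteratedFDeriv_fourier (N := ⊤)
    (fun n _ => integrable_pow_mul_comp_neg hN ha g n) hmeas (n := j) (by exact_mod_cast le_top),
    Real.fourier_continuousMultilinearMap_apply
      (VectorFourier.integrable_fourierPowSMulRight _
        (integrable_pow_mul_comp_neg hN ha g j) hmeas),
    Real.fourierInv_eq_fourier_comp_neg]
  refine congrArg (fun f : EuclideanSpace ℝ (Fin N) → ℂ => 𝓕 f y) (funext fun ξ => ?_)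
  rw [VectorFourier.fourierPowSMulRight_apply]
  change (-(2 * Real.pi * Complex.I)) ^ j • (∏ l, ⟪ξ, m l⟫) •
    ((((2 * Real.pi * ‖-ξ‖) ^ a : ℝ) : ℂ) * g (-ξ)) = _
  simp only [Complex.real_smul, smul_eq_mul, Complex.ofReal_prod,
    inner_neg_left, Complex.ofReal_neg, Finset.prod_neg, Finset.card_univ, Fintype.card_fin]
  rw [neg_pow]
  ring

lemma norm_le_sum_norm_apply_single {j : ℕ}
    (M : ContinuousMultilinearMap ℝ (fun _ : Fin j => EuclideanSpace ℝ (Fin N)) ℂ) :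
    ‖M‖ ≤ ∑ I : Fin j → Fin N, ‖M fun l => EuclideanSpace.single (I l) (1 : ℝ)‖ := by
  refine M.opNorm_le_bound (Finset.sum_nonneg fun I _ => norm_nonneg _) fun m => ?_
  have h : M m = ∑ I : Fin j → Fin N, (∏ l, m l (I l)) •
      M fun l => EuclideanSpace.single (I l) (1 : ℝ) := by
    have h1 : m = fun l => ∑ i, m l i • EuclideanSpace.single i (1 : ℝ) :=
      funext fun l => (euclidean_sum_single (m l)).symm
    conv_lhs => rw [h1]
    rw [M.map_sum]
    refine Finset.sum_congr rfl fun I _ => ?_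
    exact M.map_smul_univ (fun l => m l (I l)) fun l => EuclideanSpace.single (I l) (1 : ℝ)
  rw [h, Finset.sum_mul]
  refine (norm_sum_le _ _).trans (Finset.sum_le_sum fun I _ => ?_)
  rw [norm_smul, norm_prod, mul_comm]
  gcongr with l
  exact PiLp.norm_apply_le (m l) (I l)

/-- Each partial derivative of order j has a symbol homogeneous of degree a + j times g, so the
singularity allows decay of any order n < N + a + j. -/
lemma exists_iteratedFDeriv_fracMul_bound (hN : 2 ≤ N) {a : ℝ} (ha : -N < a)
    (g : SchwartzMap (EuclideanSpace ℝ (Fin N)) ℂ) (j n : ℕ) (hn : n - N < a + j) :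
    ∃ C, 0 ≤ C ∧ ∀ y : EuclideanSpace ℝ (Fin N),
      ‖iteratedFDeriv ℝ j (fracMul a g) y‖ ≤ C / (1 + ‖y‖) ^ n := by
  have h (I : Fin j → Fin N) := ((IsHomogSymbol.prod_coord ((2 * Real.pi * Complex.I) ^ j) I).mul
    (IsHomogSymbol.norm_rpow (2 * Real.pi) a (by positivity))).exists_decay hN n
      (by linarith) g
  choose C hC0 hC using h
  refine ⟨∑ I, C I, Finset.sum_nonneg fun I _ => hC0 I, fun y => ?_⟩
  refine (norm_le_sum_norm_apply_single _).trans ?_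
  rw [Finset.sum_div]
  refine Finset.sum_le_sum fun I _ => ?_
  rw [le_div_iff₀ (by positivity), mul_comm, iteratedFDeriv_fracMul_apply (by omega) ha]
  refine le_trans (le_of_eq ?_) (hC I y)
  refine congrArg (fun f : EuclideanSpace ℝ (Fin N) → ℂ =>
    (1 + ‖y‖) ^ n * ‖𝓕⁻ f y‖) (funext fun ξ => ?_)
  simp only [EuclideanSpace.inner_single_right, one_mul, conj_trivial]
  ring

end PotentialEstimate

end

noncomputable section

namespace PotentialEstimate

open MeasureTheory Set
open scoped RealInnerProductSpace

variable {N : ℕ}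

/-! ### The Riesz potential as a Fourier multiplier -/

lemma ae_ne_zero (hN : 0 < N) : ∀ᵐ y : EuclideanSpace ℝ (Fin N), y ≠ 0 := by
  have : Nonempty (Fin N) := ⟨⟨0, hN⟩⟩
  simp [ae_iff]

/-- As K ≥ 0, its absolute double integral against f is ∫ k|f|, so integrability of kf alone
justifies the exchange. -/
lemma integral_integral_kernel (hN : 0 < N) {K : ℝ → EuclideanSpace ℝ (Fin N) → ℝ}
    (hKm : Measurable (Function.uncurry K)) (hK0 : ∀ t ∈ Ioi (0 : ℝ), ∀ z, 0 ≤ K t z)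
    {k : EuclideanSpace ℝ (Fin N) → ℝ} (hk : ∀ z, z ≠ 0 → ∫ t in Ioi (0 : ℝ), K t z = k z)
    (hk0 : ∀ z, z ≠ 0 → 0 < k z) {f : EuclideanSpace ℝ (Fin N) → ℂ}
    (hf : AEStronglyMeasurable f volume) (hkf : Integrable fun z => (k z : ℂ) * f z) :
    ∫ t in Ioi (0 : ℝ), ∫ z, (K t z : ℂ) * f z = ∫ z, (k z : ℂ) * f z := by
  have hne := ae_ne_zero hN
  -- The integral of a non-integrable function is 0 by convention, so a positive value forces
  -- integrability.
  have hint : ∀ z, z ≠ 0 → IntegrableOn (fun t => K t z) (Ioi 0) := fun z hz =>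
    Integrable.of_integral_ne_zero (by rw [hk z hz]; exact (hk0 z hz).ne')
  have hi : Integrable (Function.uncurry fun (t : ℝ) z => (K t z : ℂ) * f z)
      ((volume.restrict (Ioi 0)).prod volume) := by
    rw [integrable_prod_iff']
    · constructor
      · filter_upwards [hne] with z hz
        exact ((hint z hz).ofReal (𝕜 := ℂ)).mul_const (f z)
      · refine hkf.norm.congr ?_
        filter_upwards [hne] with z hz
        have h1 : ∀ t ∈ Ioi (0 : ℝ), ‖(K t z : ℂ) * f z‖ = K t z * ‖f z‖ := fun t ht => by
          rw [norm_mul, Complex.norm_real, Real.norm_of_nonneg (hK0 t ht z)]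
        simp only [Function.uncurry_apply_pair]
        rw [setIntegral_congr_fun measurableSet_Ioi h1, integral_mul_const, hk z hz, norm_mul,
          Complex.norm_real, Real.norm_of_nonneg (hk0 z hz).le]
    · exact (Complex.measurable_ofReal.comp hKm).aestronglyMeasurable.mul hf.comp_snd
  rw [integral_integral_swap hi]
  refine integral_congr_ae ?_
  filter_upwards [hne] with z hz
  rw [integral_mul_const, integral_complex_ofReal, hk z hz]

lemma integral_rpow_mul_exp_neg_div {a r : ℝ} (ha : 0 < a) (hr : 0 < r) :
    ∫ t in Ioi (0 : ℝ), t ^ (-a - 1) * Real.exp (-(r / t)) = (1 / r) ^ a * Real.Gamma a := by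
  rw [← Real.integral_rpow_mul_exp_neg_mul_Ioi ha hr,
    ← integral_comp_rpow_Ioi (fun t => t ^ (a - 1) * Real.exp (-(r * t)))
      (show (-1 : ℝ) ≠ 0 by norm_num)]
  refine setIntegral_congr_fun measurableSet_Ioi fun t ht => ?_
  have ht : 0 < t := ht
  simp only [abs_neg, abs_one, one_mul, smul_eq_mul]
  rw [← Real.rpow_mul ht.le, ← mul_assoc, ← Real.rpow_add ht, Real.rpow_neg_one, div_eq_mul_inv]
  congr 2
  ring

/-- The Fourier transform is moved from F to the Gaussian, whose transform is explicit. -/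
lemma integral_gaussian_mul_fourier {F : EuclideanSpace ℝ (Fin N) → ℂ} (hF : Integrable F)
    {t : ℝ} (ht : 0 < t) :
    ∫ z, (Real.exp (-(Real.pi * t * ‖z‖ ^ 2)) : ℂ) * 𝓕 F z =
      ∫ ξ, ((t ^ (-(N : ℝ) / 2) * Real.exp (-(Real.pi * ‖ξ‖ ^ 2 / t)) : ℝ) : ℂ) * F ξ := by
  have hb : 0 < ((Real.pi * t : ℝ) : ℂ).re := by simpa using mul_pos Real.pi_pos ht
  have hG : Integrable fun v : EuclideanSpace ℝ (Fin N) =>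
      Complex.exp (-((Real.pi * t : ℝ) : ℂ) * ‖v‖ ^ 2) := by
    simpa using GaussianFourier.integrable_cexp_neg_mul_sq_norm_add hb 0
      (0 : EuclideanSpace ℝ (Fin N))
  have h : ∫ ξ, 𝓕 (fun v : EuclideanSpace ℝ (Fin N) =>
      Complex.exp (-((Real.pi * t : ℝ) : ℂ) * ‖v‖ ^ 2)) ξ • F ξ =
      ∫ z : EuclideanSpace ℝ (Fin N),
        Complex.exp (-((Real.pi * t : ℝ) : ℂ) * ‖z‖ ^ 2) • 𝓕 F z := by
    simpa using! VectorFourier.integral_fourierIntegral_smul_eq_flip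
      (L := innerₗ (EuclideanSpace ℝ (Fin N))) Real.continuous_fourierChar continuous_inner hG hF
  have e1 : ∀ z : EuclideanSpace ℝ (Fin N), (Real.exp (-(Real.pi * t * ‖z‖ ^ 2)) : ℂ) =
      Complex.exp (-((Real.pi * t : ℝ) : ℂ) * ‖z‖ ^ 2) := fun z => by
    push_cast; congr 1; ring
  simp only [e1]
  simp only [smul_eq_mul] at h
  rw [← h]
  refine integral_congr_ae (Filter.Eventually.of_forall fun ξ => ?_)
  simp only
  congr 1
  rw [fourier_gaussian_innerProductSpace hb, finrank_euclideanSpace, Fintype.card_fin]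
  have e2 : ((Real.pi : ℂ) / ((Real.pi * t : ℝ) : ℂ)) = ((t⁻¹ : ℝ) : ℂ) := by
    have := Real.pi_ne_zero
    push_cast
    field_simp
  have e3 : ((N : ℂ) / 2) = (((N : ℝ) / 2 : ℝ) : ℂ) := by push_cast; rfl
  rw [e2, e3, ← Complex.ofReal_cpow (by positivity), Real.inv_rpow ht.le, ← Real.rpow_neg ht.le,
    Complex.ofReal_mul, neg_div]
  push_cast
  congr 1
  have h1 : (Real.pi : ℂ) ≠ 0 := by exact_mod_cast Real.pi_ne_zero
  have h2 : (t : ℂ) ≠ 0 := by exact_mod_cast ht.ne'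
  field_simp

lemma one_add_norm_le (x z : EuclideanSpace ℝ (Fin N)) {r : ℝ} (hr : 1 / 2 ≤ r) :
    1 + ‖z‖ ≤ 2 * (1 + ‖x‖) * (1 + ‖x - r • z‖) := by
  have h1 : ‖r • z‖ ≤ ‖x‖ + ‖x - r • z‖ := by
    have := norm_sub_le x (x - r • z)
    simpa using this
  rw [norm_smul, Real.norm_of_nonneg (by linarith)] at h1
  nlinarith [norm_nonneg x, norm_nonneg z, norm_nonneg (x - r • z),
    mul_nonneg (norm_nonneg x) (norm_nonneg (x - r • z)),
    mul_nonneg (norm_nonneg z) (sub_nonneg.2 hr)]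

lemma div_one_add_norm_pow_le (x z : EuclideanSpace ℝ (Fin N)) {r : ℝ} (hr : 1 / 2 ≤ r)
    {C : ℝ} (hC : 0 ≤ C) (n : ℕ) :
    C / (1 + ‖x - r • z‖) ^ n ≤ C * (2 * (1 + ‖x‖)) ^ n / (1 + ‖z‖) ^ n := by
  rw [div_le_div_iff₀ (by positivity) (by positivity), mul_assoc, ← mul_pow]
  gcongr
  exact one_add_norm_le x z hr

lemma integrable_rpow_mul_fracMul (hN : 2 ≤ N) {a : ℝ} (ha : 0 < a)
    (g : SchwartzMap (EuclideanSpace ℝ (Fin N)) ℂ) (x : EuclideanSpace ℝ (Fin N)) :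
    Integrable fun z => ((‖z‖ ^ (a - N) : ℝ) : ℂ) * fracMul a g (x - z) := by
  have hN' : (2 : ℝ) ≤ N := by exact_mod_cast hN
  -- The order ⌊a⌋ + 1 exceeds a, as integrability at infinity requires, yet stays below a + N, as
  -- the decay estimate requires.
  obtain ⟨C, hC0, hC⟩ := exists_iteratedFDeriv_fracMul_bound hN (a := a) (by linarith) g 0
    (⌊a⌋₊ + 1) (by push_cast; linarith [Nat.floor_le ha.le])
  have h := (integrable_norm_rpow_div (N := N) (by omega) (p := a - N) (by linarith)
    (q := ⌊a⌋₊ + 1) (by push_cast; linarith [Nat.lt_floor_add_one a])).const_mul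
      (C * (2 * (1 + ‖x‖)) ^ (⌊a⌋₊ + 1))
  refine h.mono' ?_ (Filter.Eventually.of_forall fun z => ?_)
  · refine AEStronglyMeasurable.mul ?_ ?_
    · exact (Complex.measurable_ofReal.comp (by fun_prop)).aestronglyMeasurable
    · exact ((contDiff_fracMul (by omega) (by linarith) g).continuous.comp
        (by fun_prop : Continuous fun z => x - z)).aestronglyMeasurable
  · rw [norm_mul, Complex.norm_real, Real.norm_of_nonneg (by positivity), mul_div_left_comm]
    gcongr
    have h1 := hC (x - z)
    rw [norm_iteratedFDeriv_zero] at h1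
    have h2 := div_one_add_norm_pow_le x z (r := 1) (by norm_num) hC0 (⌊a⌋₊ + 1)
    rw [one_smul] at h2
    exact h1.trans h2

/-- Gaussian subordination: |z|^{a-N} and |ξ|^{-a} are both, up to constants, integrals over t > 0
of powers of t times Gaussians, and for each t the multiplication formula matches the two. The
factor |ξ|^{-a} then cancels the symbol, leaving Fourier inversion. -/
theorem integral_rpow_mul_fracMul (hN : 2 ≤ N) {a : ℝ} (ha : 0 < a) (haN : a < N)
    (g : SchwartzMap (EuclideanSpace ℝ (Fin N)) ℂ) (x : EuclideanSpace ℝ (Fin N)) :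
    ∫ z, ((‖z‖ ^ (a - N) : ℝ) : ℂ) * fracMul a g (x - z) =
      (rieszGamma N a : ℂ) * 𝓕⁻ (g : EuclideanSpace ℝ (Fin N) → ℂ) x := by
  have hN0 : 0 < N := by omega
  have hpi := Real.pi_pos
  have hneg : -(N : ℝ) < a := by linarith [Nat.cast_nonneg (α := ℝ) N]
  set b : ℝ := N - a with hb
  have hb0 : 0 < b := by linarith
  -- The phase is chosen so that the transform of F at z is the fractional derivative at x - z.
  let F : EuclideanSpace ℝ (Fin N) → ℂ := fun ξ =>
    Complex.exp (↑(2 * Real.pi * ⟪ξ, x⟫) * Complex.I) *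
      ((((2 * Real.pi * ‖ξ‖) ^ a : ℝ) : ℂ) * g ξ)
  have hF : Integrable F := integrable_cexp_mul (integrable_fracMul_symbol hN0 hneg g) x
  have hFF : ∀ z, fracMul a g (x - z) = 𝓕 F z := fun z => by
    rw [fracMul, Real.fourierInv_eq', Real.fourier_eq']
    refine integral_congr_ae (Filter.Eventually.of_forall fun ξ => ?_)
    simp only [smul_eq_mul, F, ← mul_assoc, ← Complex.exp_add]
    rw [inner_sub_right]
    congr 3
    push_cast
    ring
  have key1 := integral_integral_kernel hN0
    (K := fun t z => t ^ (b / 2 - 1) * Real.exp (-(Real.pi * t * ‖z‖ ^ 2)))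
    (k := fun z => (1 / Real.pi) ^ (b / 2) * Real.Gamma (b / 2) * ‖z‖ ^ (a - N))
    (by unfold Function.uncurry; fun_prop)
    (fun t ht z => mul_nonneg (Real.rpow_nonneg (le_of_lt ht) _) (Real.exp_pos _).le)
    (fun z hz => by
      have hz0 : 0 < ‖z‖ := norm_pos_iff.2 hz
      have := Real.integral_rpow_mul_exp_neg_mul_Ioi (a := b / 2) (r := Real.pi * ‖z‖ ^ 2)
        (by positivity) (by positivity)
      simp only [mul_right_comm Real.pi _ (‖z‖ ^ 2)]
      rw [this, one_div, mul_inv, Real.mul_rpow (by positivity) (by positivity), one_div,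
        ← Real.rpow_natCast, ← Real.rpow_neg hz0.le, ← Real.rpow_mul hz0.le]
      rw [show -((2 : ℕ) : ℝ) * (b / 2) = a - N by rw [hb]; push_cast; ring]
      ring)
    (fun z hz => by
      have hz0 : 0 < ‖z‖ := norm_pos_iff.2 hz
      have := Real.Gamma_pos_of_pos (show 0 < b / 2 by positivity)
      positivity)
    (f := 𝓕 F) (by
      have : 𝓕 F = fun z => fracMul a g (x - z) := funext fun z => (hFF z).symm
      rw [this]
      exact ((contDiff_fracMul hN0 hneg g).continuous.comp
        (by fun_prop : Continuous fun z => x - z)).aestronglyMeasurable)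
    (by
      have := (integrable_rpow_mul_fracMul hN ha g x).const_mul
        (((1 / Real.pi) ^ (b / 2) * Real.Gamma (b / 2) : ℝ) : ℂ)
      refine this.congr (Filter.Eventually.of_forall fun z => ?_)
      simp only [hFF]
      push_cast
      ring)
  have key2 := integral_integral_kernel hN0
    (K := fun t ξ => t ^ (-(a / 2) - 1) * Real.exp (-(Real.pi * ‖ξ‖ ^ 2 / t)))
    (k := fun ξ => (1 / Real.pi) ^ (a / 2) * Real.Gamma (a / 2) * ‖ξ‖ ^ (-a))
    (by unfold Function.uncurry; fun_prop)
    (fun t ht z => mul_nonneg (Real.rpow_nonneg (le_of_lt ht) _) (Real.exp_pos _).le)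
    (fun z hz => by
      have hz0 : 0 < ‖z‖ := norm_pos_iff.2 hz
      rw [integral_rpow_mul_exp_neg_div (a := a / 2) (r := Real.pi * ‖z‖ ^ 2)
        (by positivity) (by positivity), one_div, mul_inv,
        Real.mul_rpow (by positivity) (by positivity), one_div,
        ← Real.rpow_natCast, ← Real.rpow_neg hz0.le, ← Real.rpow_mul hz0.le]
      rw [show -((2 : ℕ) : ℝ) * (a / 2) = -a by push_cast; ring]
      ring)
    (fun z hz => by
      have hz0 : 0 < ‖z‖ := norm_pos_iff.2 hz
      have := Real.Gamma_pos_of_pos (show 0 < a / 2 by positivity)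
      positivity)
    (f := F) hF.aestronglyMeasurable
  have hcancel : ∀ᵐ ξ : EuclideanSpace ℝ (Fin N),
      (((1 / Real.pi) ^ (a / 2) * Real.Gamma (a / 2) * ‖ξ‖ ^ (-a) : ℝ) : ℂ) * F ξ =
      (((1 / Real.pi) ^ (a / 2) * Real.Gamma (a / 2) * (2 * Real.pi) ^ a : ℝ) : ℂ) *
        (Complex.exp (↑(2 * Real.pi * ⟪ξ, x⟫) * Complex.I) * g ξ) := by
    filter_upwards [ae_ne_zero hN0] with ξ hξ
    have hξ0 : 0 < ‖ξ‖ := norm_pos_iff.2 hξ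
    have e : ‖ξ‖ ^ (-a) * (2 * Real.pi * ‖ξ‖) ^ a = (2 * Real.pi) ^ a := by
      rw [Real.mul_rpow (by positivity) hξ0.le, mul_left_comm, ← Real.rpow_add hξ0]
      simp
    simp only [F]
    rw [← e]
    push_cast
    ring
  have key2 := key2 (by
    refine ((integrable_cexp_mul g.integrable x).const_mul _).congr
      (hcancel.mono fun ξ h => h.symm))
  rw [integral_congr_ae hcancel, integral_const_mul] at key2
  have hinner : ∀ t ∈ Ioi (0 : ℝ),
      ∫ z, ((t ^ (b / 2 - 1) * Real.exp (-(Real.pi * t * ‖z‖ ^ 2)) : ℝ) : ℂ) * 𝓕 F z =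
      ∫ ξ, ((t ^ (-(a / 2) - 1) * Real.exp (-(Real.pi * ‖ξ‖ ^ 2 / t)) : ℝ) : ℂ) * F ξ := by
    intro t ht
    have ht : 0 < t := ht
    have h := congrArg (fun w => ((t ^ (b / 2 - 1) : ℝ) : ℂ) * w)
      (integral_gaussian_mul_fourier hF ht)
    simp only [← integral_const_mul] at h
    have e : t ^ (-(a / 2) - 1) = t ^ (b / 2 - 1) * t ^ (-(N : ℝ) / 2) := by
      rw [← Real.rpow_add ht]; congr 1; rw [hb]; ring
    rw [e]
    simp only [Complex.ofReal_mul, mul_assoc] at h ⊢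
    exact h
  rw [setIntegral_congr_fun measurableSet_Ioi hinner, key2] at key1
  have e1 : ∀ z, (((1 / Real.pi) ^ (b / 2) * Real.Gamma (b / 2) * ‖z‖ ^ (a - N) : ℝ) : ℂ) * 𝓕 F z =
      (((1 / Real.pi) ^ (b / 2) * Real.Gamma (b / 2) : ℝ) : ℂ) *
        (((‖z‖ ^ (a - N) : ℝ) : ℂ) * fracMul a g (x - z)) := fun z => by
    rw [hFF]; push_cast; ring
  simp only [e1] at key1
  rw [integral_const_mul] at key1
  have hGb := Real.Gamma_pos_of_pos (show 0 < b / 2 by positivity)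
  have hc : (1 / Real.pi) ^ (b / 2) * Real.Gamma (b / 2) ≠ 0 := by positivity
  have hc' : (((1 / Real.pi) ^ (b / 2) * Real.Gamma (b / 2) : ℝ) : ℂ) ≠ 0 := by exact_mod_cast hc
  -- The quotient of the two subordination constants is exactly γ(a).
  have hγ : (1 / Real.pi) ^ (a / 2) * Real.Gamma (a / 2) * (2 * Real.pi) ^ a =
      (1 / Real.pi) ^ (b / 2) * Real.Gamma (b / 2) * rieszGamma N a := by
    rw [rieszGamma, ← hb, Real.mul_rpow (by norm_num) hpi.le, one_div, Real.inv_rpow hpi.le,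
      Real.inv_rpow hpi.le, ← Real.rpow_neg hpi.le, ← Real.rpow_neg hpi.le]
    have : Real.pi ^ (-(a / 2)) * Real.pi ^ a = Real.pi ^ (-(b / 2)) * Real.pi ^ ((N : ℝ) / 2) := by
      rw [← Real.rpow_add hpi, ← Real.rpow_add hpi]; congr 1; rw [hb]; ring
    field_simp
    exact this
  rw [hγ, Complex.ofReal_mul, mul_assoc] at key1
  rw [Real.fourierInv_eq']
  simp only [smul_eq_mul]
  exact (mul_left_cancel₀ hc' key1).symm

end PotentialEstimate

end

noncomputable section

namespace PotentialEstimate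

open MeasureTheory Set
open scoped RealInnerProductSpace

variable {N : ℕ}

/-! ### Radial derivatives under the Riesz potential -/

lemma norm_apply_neg_const_le {j : ℕ}
    (M : ContinuousMultilinearMap ℝ (fun _ : Fin j => EuclideanSpace ℝ (Fin N)) ℂ)
    (z : EuclideanSpace ℝ (Fin N)) : ‖M fun _ => -z‖ ≤ ‖M‖ * ‖z‖ ^ j := by
  refine (M.le_opNorm _).trans_eq ?_
  simp

/-- A majorant independent of r ≥ 1/2, for differentiating under the integral near r = 1. The j
factors z improve the singularity and are paid for at infinity by the j extra orders of decay. -/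
lemma exists_radial_deriv_bound (hN : 2 ≤ N) {a : ℝ} (ha : 0 < a)
    (g : SchwartzMap (EuclideanSpace ℝ (Fin N)) ℂ) (x : EuclideanSpace ℝ (Fin N)) (j : ℕ) :
    ∃ B : EuclideanSpace ℝ (Fin N) → ℝ, Integrable B ∧ ∀ r : ℝ, 1 / 2 ≤ r → ∀ z, z ≠ 0 →
      ‖((‖z‖ ^ (a - N) : ℝ) : ℂ) *
        iteratedFDeriv ℝ j (fracMul a g) (x - r • z) fun _ => -z‖ ≤ B z := by
  have hN' : (2 : ℝ) ≤ N := by exact_mod_cast hN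
  have hj : (0 : ℝ) ≤ j := by positivity
  have haj : 0 ≤ a + j := by positivity
  obtain ⟨C, hC0, hC⟩ := exists_iteratedFDeriv_fracMul_bound hN (a := a) (by linarith) g j
    (⌊a + j⌋₊ + 1) (by push_cast; linarith [Nat.floor_le haj])
  refine ⟨_, (integrable_norm_rpow_div (N := N) (by omega) (p := a - N + j) (by linarith)
    (q := ⌊a + j⌋₊ + 1) (by push_cast; linarith [Nat.lt_floor_add_one (a + j)])).const_mul
      (C * (2 * (1 + ‖x‖)) ^ (⌊a + j⌋₊ + 1)), fun r hr z hz => ?_⟩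
  have hz0 : 0 < ‖z‖ := norm_pos_iff.2 hz
  rw [norm_mul, Complex.norm_real, Real.norm_of_nonneg (by positivity), Real.rpow_add hz0,
    Real.rpow_natCast, mul_div_left_comm, mul_assoc]
  gcongr
  refine (norm_apply_neg_const_le _ _).trans ?_
  rw [mul_comm]
  gcongr
  exact (hC _).trans (div_one_add_norm_pow_le x z hr hC0 _)

lemma aestronglyMeasurable_radial_deriv (hN : 2 ≤ N) {a : ℝ} (ha : 0 < a)
    (g : SchwartzMap (EuclideanSpace ℝ (Fin N)) ℂ) (x : EuclideanSpace ℝ (Fin N)) (j : ℕ) (r : ℝ) :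
    AEStronglyMeasurable (fun z => ((‖z‖ ^ (a - N) : ℝ) : ℂ) *
        iteratedFDeriv ℝ j (fracMul a g) (x - r • z) fun _ => -z) volume := by
  refine AEStronglyMeasurable.mul ?_ (Continuous.aestronglyMeasurable ?_)
  · exact (Complex.measurable_ofReal.comp (by fun_prop)).aestronglyMeasurable
  · have h := (contDiff_fracMul (N := N) (by omega)
      (by linarith [Nat.cast_nonneg (α := ℝ) N] : -(N : ℝ) < a) g).continuous_iteratedFDeriv
        (m := j) (by exact_mod_cast le_top)
    have h2 : Continuous fun z : EuclideanSpace ℝ (Fin N) =>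
        iteratedFDeriv ℝ j (fracMul a g) (x - r • z) := h.comp (by fun_prop)
    exact h2.eval (by fun_prop)

lemma integrable_radial_deriv (hN : 2 ≤ N) {a : ℝ} (ha : 0 < a)
    (g : SchwartzMap (EuclideanSpace ℝ (Fin N)) ℂ) (x : EuclideanSpace ℝ (Fin N)) (j : ℕ)
    {r : ℝ} (hr : 1 / 2 ≤ r) :
    Integrable fun z => ((‖z‖ ^ (a - N) : ℝ) : ℂ) *
        iteratedFDeriv ℝ j (fracMul a g) (x - r • z) fun _ => -z := by
  obtain ⟨B, hB, hle⟩ := exists_radial_deriv_bound hN ha g x j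
  refine hB.mono' (aestronglyMeasurable_radial_deriv hN ha g x j r) ?_
  filter_upwards [ae_ne_zero (N := N) (by omega)] with z hz using hle r hr z hz

lemma hasDerivAt_iteratedFDeriv_ray {f : EuclideanSpace ℝ (Fin N) → ℂ} (hf : ContDiff ℝ ∞ f)
    (x z : EuclideanSpace ℝ (Fin N)) (j : ℕ) (r : ℝ) :
    HasDerivAt (fun r : ℝ => iteratedFDeriv ℝ j f (x - r • z) fun _ => -z)
      (iteratedFDeriv ℝ (j + 1) f (x - r • z) fun _ => -z) r := by
  have h1 : HasDerivAt (fun r : ℝ => x - r • z) (-z) r := by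
    simpa using ((hasDerivAt_id r).smul_const z).const_sub x
  have h2 := ((hf.differentiable_iteratedFDeriv (m := j)
    (by exact_mod_cast ENat.natCast_lt_top j)) (x - r • z)).hasFDerivAt.comp_hasDerivAt r h1
  have h3 := (ContinuousMultilinearMap.apply ℝ (fun _ : Fin j => EuclideanSpace ℝ (Fin N)) ℂ
    fun _ => -z).hasFDerivAt.comp_hasDerivAt r h2
  exact h3

lemma hasDerivAt_integral_radial_deriv (hN : 2 ≤ N) {a : ℝ} (ha : 0 < a)
    (g : SchwartzMap (EuclideanSpace ℝ (Fin N)) ℂ) (x : EuclideanSpace ℝ (Fin N)) (j : ℕ)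
    {r : ℝ} (hr : 1 / 2 < r) :
    HasDerivAt (fun r : ℝ => ∫ z, ((‖z‖ ^ (a - N) : ℝ) : ℂ) *
        iteratedFDeriv ℝ j (fracMul a g) (x - r • z) fun _ => -z)
      (∫ z, ((‖z‖ ^ (a - N) : ℝ) : ℂ) *
        iteratedFDeriv ℝ (j + 1) (fracMul a g) (x - r • z) fun _ => -z) r := by
  obtain ⟨B, hB, hle⟩ := exists_radial_deriv_bound hN ha g x (j + 1)
  have hsm := contDiff_fracMul (N := N) (by omega)
      (by linarith [Nat.cast_nonneg (α := ℝ) N] : -(N : ℝ) < a) g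
  refine (hasDerivAt_integral_of_dominated_loc_of_deriv_le (s := Ioi (1 / 2))
    (F' := fun r z => ((‖z‖ ^ (a - N) : ℝ) : ℂ) *
        iteratedFDeriv ℝ (j + 1) (fracMul a g) (x - r • z) fun _ => -z) (Ioi_mem_nhds hr)
    (Filter.Eventually.of_forall fun r => aestronglyMeasurable_radial_deriv hN ha g x j r)
    (integrable_radial_deriv hN ha g x j hr.le)
    (aestronglyMeasurable_radial_deriv hN ha g x (j + 1) r) ?_ hB ?_).2
  · filter_upwards [ae_ne_zero (N := N) (by omega)] with z hz r hr using hle r (le_of_lt hr) z hz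
  · exact Filter.Eventually.of_forall fun z r _ =>
      (hasDerivAt_iteratedFDeriv_ray hsm x z j r).const_mul _

lemma integral_rpow_mul_comp_smul (a : ℝ) (f : EuclideanSpace ℝ (Fin N) → ℂ)
    {r : ℝ} (hr : 0 < r) :
    ∫ z, ((‖z‖ ^ (a - N) : ℝ) : ℂ) * f (r • z) =
      ((r ^ (-a) : ℝ) : ℂ) * ∫ z, ((‖z‖ ^ (a - N) : ℝ) : ℂ) * f z := by
  have h := Measure.integral_comp_smul volume
    (fun z : EuclideanSpace ℝ (Fin N) => ((‖z‖ ^ (a - N) : ℝ) : ℂ) * f z) r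
  rw [finrank_euclideanSpace, Fintype.card_fin, abs_of_nonneg (by positivity)] at h
  have e : ∀ z : EuclideanSpace ℝ (Fin N), ((‖r • z‖ ^ (a - N) : ℝ) : ℂ) * f (r • z) =
      ((r ^ (a - N) : ℝ) : ℂ) * (((‖z‖ ^ (a - N) : ℝ) : ℂ) * f (r • z)) := fun z => by
    rw [norm_smul, Real.norm_of_nonneg hr.le, Real.mul_rpow hr.le (norm_nonneg z)]
    push_cast; ring
  simp only [e] at h
  rw [integral_const_mul, Complex.real_smul] at h
  have e2 : (r ^ N)⁻¹ = r ^ (a - N) * r ^ (-a) := by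
    rw [← Real.rpow_add hr, ← Real.rpow_natCast, ← Real.rpow_neg hr.le]; congr 1; ring
  rw [e2, Complex.ofReal_mul, mul_assoc] at h
  have hne : ((r ^ (a - N) : ℝ) : ℂ) ≠ 0 := by
    exact_mod_cast (Real.rpow_pos_of_pos hr _).ne'
  exact mul_left_cancel₀ hne h

/-- The case j = 0 is the change of variables z ↦ rz; each further derivative in r is computed both
under the integral and on the explicit power of r. -/
lemma integral_radial_deriv_ray (hN : 2 ≤ N) {a : ℝ} (ha : 0 < a)
    (g : SchwartzMap (EuclideanSpace ℝ (Fin N)) ℂ) (x : EuclideanSpace ℝ (Fin N)) (j : ℕ)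
    {r : ℝ} (hr : 1 / 2 < r) :
    ∫ z, ((‖z‖ ^ (a - N) : ℝ) : ℂ) *
        iteratedFDeriv ℝ j (fracMul a g) (x - r • z) (fun _ => -z) =
      ((fallingFactorial (-a) j * r ^ (-a - j) : ℝ) : ℂ) *
        ∫ z, ((‖z‖ ^ (a - N) : ℝ) : ℂ) * fracMul a g (x - z) := by
  induction j generalizing r with
  | zero =>
    simpa using integral_rpow_mul_comp_smul a (fun z => fracMul a g (x - z))
      (by linarith : 0 < r)
  | succ j ih =>
    have hr0 : 0 < r := by linarith
    have h1 := hasDerivAt_integral_radial_deriv hN ha g x j hr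
    have h2 : HasDerivAt (fun r : ℝ => ((fallingFactorial (-a) j * r ^ (-a - j) : ℝ) : ℂ) *
        ∫ z, ((‖z‖ ^ (a - N) : ℝ) : ℂ) * fracMul a g (x - z)) _ r :=
      (((Real.hasDerivAt_rpow_const (p := -a - j) (Or.inl hr0.ne')).const_mul
        (fallingFactorial (-a) j)).ofReal_comp).mul_const _
    have h3 := h2.congr_of_eventuallyEq (f₁ := fun r : ℝ => ∫ z, ((‖z‖ ^ (a - N) : ℝ) : ℂ) *
        iteratedFDeriv ℝ j (fracMul a g) (x - r • z) fun _ => -z)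
      (by filter_upwards [Ioi_mem_nhds hr] with t ht using ih ht)
    rw [h1.unique h3, fallingFactorial_succ,
      show -a - ((j + 1 : ℕ) : ℝ) = -a - j - 1 by push_cast; ring]
    push_cast
    ring

theorem integral_rpow_mul_radial_deriv (hN : 2 ≤ N) {a : ℝ} (ha : 0 < a) (haN : a < N)
    (g : SchwartzMap (EuclideanSpace ℝ (Fin N)) ℂ) (x : EuclideanSpace ℝ (Fin N)) (j : ℕ) :
    (Integrable fun z => ((‖z‖ ^ (a - N) : ℝ) : ℂ) *
        iteratedFDeriv ℝ j (fracMul a g) (x - z) (fun _ => z)) ∧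
    ∫ z, ((‖z‖ ^ (a - N) : ℝ) : ℂ) *
        iteratedFDeriv ℝ j (fracMul a g) (x - z) (fun _ => z) =
      (((-1) ^ j * fallingFactorial (-a) j * rieszGamma N a : ℝ) : ℂ) *
        𝓕⁻ (g : EuclideanSpace ℝ (Fin N) → ℂ) x := by
  have e : ∀ z : EuclideanSpace ℝ (Fin N), ((‖z‖ ^ (a - N) : ℝ) : ℂ) *
        iteratedFDeriv ℝ j (fracMul a g) (x - z) (fun _ => z) = (((-1) ^ j : ℝ) : ℂ) *
        (((‖z‖ ^ (a - N) : ℝ) : ℂ) *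
          iteratedFDeriv ℝ j (fracMul a g) (x - (1 : ℝ) • z) (fun _ => -z)) := fun z => by
    have h := (iteratedFDeriv ℝ j (fracMul a g) (x - z)).map_smul_univ (fun _ => (-1 : ℝ))
      fun _ => -z
    simp only [neg_smul, one_smul, neg_neg, Finset.prod_const, Finset.card_univ,
      Fintype.card_fin, Complex.real_smul] at h
    rw [one_smul, h]
    ring
  simp only [e]
  refine ⟨(integrable_radial_deriv hN ha g x j (by norm_num)).const_mul _, ?_⟩
  rw [integral_const_mul, integral_radial_deriv_ray hN ha g x j (by norm_num),
    integral_rpow_mul_fracMul hN ha haN, Real.one_rpow]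
  push_cast
  ring

end PotentialEstimate

end

noncomputable section

namespace PotentialEstimate

open MeasureTheory Set
open scoped RealInnerProductSpace

variable {N : ℕ}

/-! ### Contraction of the radial tensor with the derivatives -/

lemma integrable_prod_inner_mul_symbol (hN : 0 < N) {a : ℝ} (ha : -N < a)
    (g : SchwartzMap (EuclideanSpace ℝ (Fin N)) ℂ) {j : ℕ}
    (m : Fin j → EuclideanSpace ℝ (Fin N)) :
    Integrable fun ξ : EuclideanSpace ℝ (Fin N) =>
      ((2 * Real.pi * Complex.I) ^ j * ∏ l, ((⟪ξ, m l⟫ : ℝ) : ℂ)) *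
        ((((2 * Real.pi * ‖ξ‖) ^ a : ℝ) : ℂ) * g ξ) := by
  have h := (integrable_pow_mul_fracMul_symbol hN ha g j).const_mul
    (‖(2 * Real.pi * Complex.I : ℂ) ^ j‖ * ∏ l, ‖m l‖)
  refine h.mono' ?_ (Filter.Eventually.of_forall fun ξ => ?_)
  · refine AEStronglyMeasurable.mul (Continuous.aestronglyMeasurable (by fun_prop))
      (integrable_fracMul_symbol hN ha g).aestronglyMeasurable
  · have h1 : ∏ l, ‖((⟪ξ, m l⟫ : ℝ) : ℂ)‖ ≤ (∏ l, ‖m l‖) * ‖ξ‖ ^ j := by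
      calc _ ≤ ∏ l, (‖m l‖ * ‖ξ‖) := by
            gcongr with l
            rw [Complex.norm_real, mul_comm]
            exact norm_inner_le_norm ξ (m l)
        _ = _ := by
            rw [Finset.prod_mul_distrib]
            simp
    rw [norm_mul, norm_mul, norm_prod]
    refine (mul_le_mul_of_nonneg_right (mul_le_mul_of_nonneg_left h1 (norm_nonneg _))
      (norm_nonneg _)).trans_eq ?_
    ring

/-- On the Fourier side this is the generating polynomial of T at ξ: |ξ|^{2b} raises the order of
the multiplier from a to a + 2b, and i^{2b} supplies the sign (-1)^b. -/
lemma sum_radialTensor_mul_iteratedFDeriv (hN : 0 < N) {a : ℝ} (ha : 0 < a)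
    (g : SchwartzMap (EuclideanSpace ℝ (Fin N)) ℂ) (s : ℝ) (k : ℕ)
    {z : EuclideanSpace ℝ (Fin N)} (hz : z ≠ 0) (y : EuclideanSpace ℝ (Fin N)) :
    ∑ I : Fin k → Fin N, (radialTensor s z I : ℂ) *
        iteratedFDeriv ℝ k (fracMul a g) y (fun l => EuclideanSpace.single (I l) (1 : ℝ)) =
      ∑ b ∈ Finset.range (k + 1),
        ((radialCoeff s k b * ‖z‖ ^ (s - 2 * (k - b)) * (-1) ^ b : ℝ) : ℂ) *
          iteratedFDeriv ℝ (k - 2 * b) (fracMul (a + 2 * b) g) y (fun _ => z) := by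
  have hneg (b : ℕ) : -(N : ℝ) < a + 2 * b := by
    linarith [Nat.cast_nonneg (α := ℝ) N, Nat.cast_nonneg (α := ℝ) b]
  have hneg0 : -(N : ℝ) < a := by simpa using hneg 0
  have hL (I : Fin k → Fin N) := iteratedFDeriv_fracMul_apply hN hneg0 g k y
    fun l => EuclideanSpace.single (I l) (1 : ℝ)
  have hR (b : ℕ) := iteratedFDeriv_fracMul_apply hN (hneg b) g (k - 2 * b) y fun _ => z
  simp only [hL, hR, Real.fourierInv_eq', smul_eq_mul, ← integral_const_mul]
  rw [← integral_finsetSum _ fun I _ => (integrable_cexp_mul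
      (integrable_prod_inner_mul_symbol hN hneg0 g _) y).const_mul _,
    ← integral_finsetSum _ fun b _ => (integrable_cexp_mul
      (integrable_prod_inner_mul_symbol hN (hneg b) g _) y).const_mul _]
  refine integral_congr_ae (Filter.Eventually.of_forall fun ξ => ?_)
  have h := congrArg (fun t : ℝ => (t : ℂ)) (sum_radialTensor_mul_prod s k hz ξ)
  simp only [Complex.ofReal_sum, Complex.ofReal_mul, Complex.ofReal_prod] at h
  have hl : ∑ I : Fin k → Fin N, (radialTensor s z I : ℂ) *
      (Complex.exp (↑(2 * Real.pi * ⟪ξ, y⟫) * Complex.I) *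
        (((2 * Real.pi * Complex.I) ^ k *
          ∏ l, ((⟪ξ, EuclideanSpace.single (I l) (1 : ℝ)⟫ : ℝ) : ℂ)) *
            ((((2 * Real.pi * ‖ξ‖) ^ a : ℝ) : ℂ) * g ξ))) =
      (∑ I : Fin k → Fin N, (radialTensor s z I : ℂ) * ∏ l, ((ξ (I l) : ℝ) : ℂ)) *
      (Complex.exp (↑(2 * Real.pi * ⟪ξ, y⟫) * Complex.I) *
        ((2 * Real.pi * Complex.I) ^ k * ((((2 * Real.pi * ‖ξ‖) ^ a : ℝ) : ℂ) * g ξ))) := by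
    rw [Finset.sum_mul]
    refine Finset.sum_congr rfl fun I _ => ?_
    simp only [EuclideanSpace.inner_single_right, one_mul, conj_trivial]
    ring
  beta_reduce
  rw [hl, h, Finset.sum_mul]
  refine Finset.sum_congr rfl fun b _ => ?_
  -- For k < 2b the subtraction k - 2b truncates, harmlessly, since the coefficient vanishes.
  rcases lt_or_ge k (2 * b) with hb | hb
  · simp [radialCoeff_eq_zero s hb]
  · obtain ⟨p, rfl⟩ := Nat.exists_eq_add_of_le hb
    rw [show 2 * b + p - 2 * b = p by omega]
    have e : (2 * Real.pi * ‖ξ‖) ^ (a + 2 * b) =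
        (2 * Real.pi * ‖ξ‖) ^ a * ((2 * Real.pi) ^ 2) ^ b * (‖ξ‖ ^ 2) ^ b := by
      rw [Real.rpow_add' (by positivity) (by positivity),
        show (2 : ℝ) * b = ((2 * b : ℕ) : ℝ) by push_cast; ring,
        Real.rpow_natCast, pow_mul]
      ring
    have e2 : (2 * Real.pi * Complex.I) ^ (2 * b + p) =
        ((2 * Real.pi : ℂ) ^ 2) ^ b * (-1) ^ b * (2 * Real.pi * Complex.I) ^ p := by
      rw [pow_add, pow_mul, mul_pow _ Complex.I, Complex.I_sq, mul_pow]
    rw [e, e2, real_inner_comm z ξ]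
    simp only [Finset.prod_const, Finset.card_univ, Fintype.card_fin]
    push_cast
    ring

/-! ### Bounds for the gradient -/

lemma norm_sum_radialTensor_mul_le (f : EuclideanSpace ℝ (Fin N) → ℂ) (s : ℝ) (k : ℕ)
    {z : EuclideanSpace ℝ (Fin N)} (hz : z ≠ 0) (y : EuclideanSpace ℝ (Fin N)) :
    ‖∑ I : Fin k → Fin N, (radialTensor s z I : ℂ) *
        iteratedFDeriv ℝ k f y (fun l => EuclideanSpace.single (I l) (1 : ℝ))‖ ≤
      Real.sqrt (lam N s k) * ‖z‖ ^ (s - k) * gradNorm k f y := by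
  have h1 := Real.sum_mul_le_sqrt_mul_sqrt Finset.univ
    (fun I : Fin k → Fin N => ‖radialTensor s z I‖)
    (fun I => ‖iteratedFDeriv ℝ k f y (fun l => EuclideanSpace.single (I l) (1 : ℝ))‖)
  simp only [Real.norm_eq_abs, sq_abs] at h1
  rw [sum_radialTensor_sq s k hz, Real.sqrt_mul' _ (by positivity), two_mul,
    Real.rpow_add (norm_pos_iff.2 hz), Real.sqrt_mul_self (by positivity)] at h1
  refine (norm_sum_le _ _).trans (le_trans (le_of_eq ?_) h1)
  refine Finset.sum_congr rfl fun I _ => ?_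
  rw [norm_mul, Complex.norm_real, Real.norm_eq_abs]

lemma gradNorm_le (k : ℕ) (f : EuclideanSpace ℝ (Fin N) → ℂ) (y : EuclideanSpace ℝ (Fin N)) :
    gradNorm k f y ≤ Real.sqrt (Fintype.card (Fin k → Fin N)) * ‖iteratedFDeriv ℝ k f y‖ := by
  rw [gradNorm, ← Real.sqrt_sq (norm_nonneg (iteratedFDeriv ℝ k f y)),
    ← Real.sqrt_mul (by positivity)]
  refine Real.sqrt_le_sqrt ?_
  rw [← nsmul_eq_mul, ← Finset.card_univ]
  refine Finset.sum_le_card_nsmul _ _ _ fun I _ => ?_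
  gcongr
  refine ((iteratedFDeriv ℝ k f y).le_opNorm _).trans_eq ?_
  simp

lemma integrable_rpow_mul_gradNorm (hN : 2 ≤ N) {a : ℝ} (ha : 0 < a) (k m : ℕ) (hm : a + k = m)
    (g : SchwartzMap (EuclideanSpace ℝ (Fin N)) ℂ) (x : EuclideanSpace ℝ (Fin N)) :
    Integrable fun z => ‖z‖ ^ ((m : ℝ) - N) * gradNorm k (fracMul a g) (x - z) := by
  have hN' : (2 : ℝ) ≤ N := by exact_mod_cast hN
  have hk : (0 : ℝ) ≤ k := by positivity
  obtain ⟨C, hC0, hC⟩ := exists_iteratedFDeriv_fracMul_bound hN (a := a) (by linarith) g k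
    (m + 1) (by push_cast; linarith)
  set D := Real.sqrt (Fintype.card (Fin k → Fin N))
  refine ((integrable_norm_rpow_div (N := N) (by omega) (p := m - N) (by linarith)
    (q := m + 1) (by push_cast; linarith)).const_mul
      (D * (C * (2 * (1 + ‖x‖)) ^ (m + 1)))).mono' ?_ (Filter.Eventually.of_forall fun z => ?_)
  · refine AEStronglyMeasurable.mul (Measurable.aestronglyMeasurable (by fun_prop))
      (Continuous.aestronglyMeasurable ?_)
    have h := (contDiff_fracMul (N := N) (by omega)
      (by linarith : -(N : ℝ) < a) g).continuous_iteratedFDeriv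
        (m := k) (by exact_mod_cast le_top)
    unfold gradNorm
    refine Real.continuous_sqrt.comp (continuous_finsetSum _ fun I _ => ?_)
    exact (((h.comp (by fun_prop : Continuous fun z => x - z)).eval continuous_const).norm.pow 2)
  · have hg0 : 0 ≤ gradNorm k (fracMul a g) (x - z) := Real.sqrt_nonneg _
    rw [Real.norm_of_nonneg (mul_nonneg (by positivity) hg0), mul_div_left_comm,
      mul_div_assoc]
    gcongr
    refine (gradNorm_le k _ _).trans ?_
    gcongr
    have h := div_one_add_norm_pow_le x z (r := 1) (by norm_num) hC0 (m + 1)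
    rw [one_smul] at h
    exact (hC _).trans h

/-! ### The potential estimate -/

lemma rieszGamma_pos {a : ℝ} (ha : 0 < a) (haN : a < N) : 0 < rieszGamma N a := by
  have h1 := Real.Gamma_pos_of_pos (show 0 < a / 2 by positivity)
  have h2 := Real.Gamma_pos_of_pos (show 0 < ((N : ℝ) - a) / 2 by linarith)
  unfold rieszGamma
  positivity

lemma rieszGamma_add_two {a : ℝ} (ha : 0 < a) (haN : a + 2 < N) :
    rieszGamma N (a + 2) = a * (N - a - 2) * rieszGamma N a := by
  have h2 := Real.Gamma_pos_of_pos (show 0 < ((N : ℝ) - a) / 2 - 1 by linarith)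
  have e1 : Real.Gamma ((a + 2) / 2) = a / 2 * Real.Gamma (a / 2) := by
    rw [← Real.Gamma_add_one (by positivity)]; congr 1; ring
  have e2 : Real.Gamma (((N : ℝ) - a) / 2) =
      (((N : ℝ) - a) / 2 - 1) * Real.Gamma (((N : ℝ) - a) / 2 - 1) := by
    rw [← Real.Gamma_add_one (by linarith)]; congr 1; ring
  have h3 : ((N : ℝ) - a) / 2 - 1 ≠ 0 := by linarith
  unfold rieszGamma
  rw [e1, e2, show ((N : ℝ) - (a + 2)) / 2 = ((N : ℝ) - a) / 2 - 1 by ring,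
    Real.rpow_add (by norm_num), Real.rpow_two]
  rw [show (N : ℝ) - a - 2 = 2 * (((N : ℝ) - a) / 2 - 1) by ring]
  have h4 := h2.ne'
  generalize ((N : ℝ) - a) / 2 - 1 = c at *
  field_simp

/-- Each step a → a + 2 multiplies γ by a(N - a - 2), the negative of the factor by which Δ acts on
|z|^{-a}. -/
lemma neg_one_pow_mul_rieszGamma {a : ℝ} (ha : 0 < a) (b : ℕ) (hb : a + 2 * b < N) :
    (-1) ^ b * rieszGamma N (a + 2 * b) = lapFactor N (-a) b * rieszGamma N a := by
  induction b with
  | zero => simp [lapFactor]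
  | succ b ih =>
    push_cast at hb
    have hb0 : (0 : ℝ) ≤ b := by positivity
    have h := rieszGamma_add_two (N := N) (a := a + 2 * b) (by positivity) (by linarith)
    rw [lapFactor, Finset.prod_range_succ, ← lapFactor, mul_right_comm, ← ih (by linarith),
      show a + 2 * ((b + 1 : ℕ) : ℝ) = a + 2 * b + 2 by push_cast; ring, h]
    ring

/-- The weight |z|^{2m-N} makes the b-th term carry |z|^{(a+2b)-N}, the Riesz kernel of order a +
2b. Since a + 2b ≤ m < N, each such potential is admissible. -/
theorem integral_radialTensor_mul_iteratedFDeriv {k m : ℕ} (hkm : k < m) (hmN : m < N)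
    (hN : 2 ≤ N) (g : SchwartzMap (EuclideanSpace ℝ (Fin N)) ℂ)
    (x : EuclideanSpace ℝ (Fin N)) :
    ∫ z, ((‖z‖ ^ (2 * (m : ℝ) - N) : ℝ) : ℂ) *
      ∑ I : Fin k → Fin N, (radialTensor ((k : ℝ) - m) z I : ℂ) *
        iteratedFDeriv ℝ k (fracMul ((m : ℝ) - k) g) (x - z)
          (fun l => EuclideanSpace.single (I l) (1 : ℝ)) =
      (((-1) ^ k * rieszGamma N ((m : ℝ) - k) * lam N ((k : ℝ) - m) k : ℝ) : ℂ) *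
        𝓕⁻ (g : EuclideanSpace ℝ (Fin N) → ℂ) x := by
  set a : ℝ := (m : ℝ) - k with ha
  have hkm' : (k : ℝ) < m := by exact_mod_cast hkm
  have hmN' : (m : ℝ) < N := by exact_mod_cast hmN
  have ha0 : 0 < a := by linarith
  have hs : (k : ℝ) - m = -a := by rw [ha]; ring
  rw [hs]
  have hb (b : ℕ) (hb : 2 * b ≤ k) := integral_rpow_mul_radial_deriv hN (a := a + 2 * b)
    (by positivity) (by
      have : 2 * (b : ℝ) ≤ k := by exact_mod_cast hb
      linarith) g x (k - 2 * b)
  have hpt : ∀ᵐ z : EuclideanSpace ℝ (Fin N), ((‖z‖ ^ (2 * (m : ℝ) - N) : ℝ) : ℂ) *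
      ∑ I : Fin k → Fin N, (radialTensor (-a) z I : ℂ) *
        iteratedFDeriv ℝ k (fracMul a g) (x - z)
          (fun l => EuclideanSpace.single (I l) (1 : ℝ)) =
      ∑ b ∈ Finset.range (k / 2 + 1), ((radialCoeff (-a) k b * (-1) ^ b : ℝ) : ℂ) *
        (((‖z‖ ^ (a + 2 * b - N) : ℝ) : ℂ) *
          iteratedFDeriv ℝ (k - 2 * b) (fracMul (a + 2 * b) g) (x - z) (fun _ => z)) := by
    filter_upwards [ae_ne_zero (N := N) (by omega)] with z hz
    rw [sum_radialTensor_mul_iteratedFDeriv (by omega) ha0 g (-a) k hz, Finset.mul_sum]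
    symm
    refine Finset.sum_subset_zero_on_sdiff (fun n hn => ?_) (fun n hn => ?_) (fun b _ => ?_)
    · simp at hn ⊢; omega
    · simp at hn
      rw [radialCoeff_eq_zero _ (by omega)]; simp
    · have e : ‖z‖ ^ (a + 2 * b - N) =
          ‖z‖ ^ (2 * (m : ℝ) - N) * ‖z‖ ^ (-a - 2 * (k - b)) := by
        rw [← Real.rpow_add (norm_pos_iff.2 hz)]; congr 1; rw [ha]; ring
      rw [e]
      push_cast
      ring
  rw [integral_congr_ae hpt, integral_finsetSum _ fun b hbm => ((hb b (by
    simp at hbm; omega)).1.const_mul _), ← sum_radialCoeff_mul_eq_lam, Finset.mul_sum,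
    Complex.ofReal_sum, Finset.sum_mul]
  refine Finset.sum_congr rfl fun b hbm => ?_
  have hbk : 2 * b ≤ k := by simp at hbm; omega
  have hbk' : 2 * (b : ℝ) ≤ k := by exact_mod_cast hbk
  rw [integral_const_mul, (hb b hbk).2, ← mul_assoc, ← Complex.ofReal_mul]
  congr 2
  have hγ := neg_one_pow_mul_rieszGamma (N := N) ha0 b (by linarith)
  have hsgn : (-1 : ℝ) ^ k = (-1) ^ (k - 2 * b) := by
    obtain ⟨p, rfl⟩ := Nat.exists_eq_add_of_le hbk
    rw [show 2 * b + p - 2 * b = p by omega, pow_add, pow_mul]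
    simp
  rw [hsgn, show -a - 2 * (b : ℝ) = -(a + 2 * b) by ring]
  linear_combination (radialCoeff (-a) k b * (-1) ^ (k - 2 * b) *
    fallingFactorial (-(a + 2 * b)) (k - 2 * b)) * hγ

theorem norm_fourierInv_le_rieszPotential {k m : ℕ} (hmN : m < N) (hk : 1 ≤ k) (hkm1 : k < m)
    (g : SchwartzMap (EuclideanSpace ℝ (Fin N)) ℂ) (x : EuclideanSpace ℝ (Fin N)) :
    Integrable (fun y => gradNorm k (fracMul ((m : ℝ) - k) g) y / ‖x - y‖ ^ ((N : ℝ) - m)) ∧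
      ‖𝓕⁻ (g : EuclideanSpace ℝ (Fin N) → ℂ) x‖ ≤
        rieszGamma N m / (rieszGamma N ((m : ℝ) - k) * Real.sqrt (lam N ((k : ℝ) - m) k)) *
          rieszPotential m (gradNorm k (fracMul ((m : ℝ) - k) g)) x := by
  have hN : 3 ≤ N := by omega
  have hkm' : (k : ℝ) < m := by exact_mod_cast hkm1
  have hmN' : (m : ℝ) < N := by exact_mod_cast hmN
  have hk' : (1 : ℝ) ≤ k := by exact_mod_cast hk
  set G := gradNorm k (fracMul ((m : ℝ) - k) g) with hG
  have hint := integrable_rpow_mul_gradNorm (N := N) (by omega) (a := (m : ℝ) - k) (by linarith) k m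
    (by ring) g x
  have hform : ∀ y, ‖x - y‖ ^ ((m : ℝ) - N) * G (x - (x - y)) =
      G y / ‖x - y‖ ^ ((N : ℝ) - m) := fun y => by
    rw [sub_sub_cancel, div_eq_mul_inv, ← Real.rpow_neg (norm_nonneg _), neg_sub, mul_comm]
  have hint2 := hint.comp_sub_left x
  simp only [← hG, hform] at hint2
  refine ⟨hint2, ?_⟩
  have hJ : ∫ y, G y / ‖x - y‖ ^ ((N : ℝ) - m) = ∫ z, ‖z‖ ^ ((m : ℝ) - N) * G (x - z) := by
    rw [← integral_sub_left_eq_self (fun z => ‖z‖ ^ ((m : ℝ) - N) * G (x - z)) volume x]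
    simp only [hform]
  have hmain := integral_radialTensor_mul_iteratedFDeriv hkm1 hmN (by omega) g x
  have hlam := lam_pos N hN ((k : ℝ) - m) (by linarith) k
  have hγ := rieszGamma_pos (N := N) (a := (m : ℝ) - k) (by linarith) (by linarith)
  have hγm := rieszGamma_pos (N := N) (a := (m : ℝ)) (by linarith) hmN'
  -- Cauchy–Schwarz in the tensor indices: |T| = √λ |z|^{-m} lowers the weight to |z|^{m-N}, leaving
  -- √λ here against λ in the exact identity.
  have hle := norm_integral_le_of_norm_le (hint.const_mul (Real.sqrt (lam N ((k : ℝ) - m) k)))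
    (f := fun z => ((‖z‖ ^ (2 * (m : ℝ) - N) : ℝ) : ℂ) *
      ∑ I : Fin k → Fin N, (radialTensor ((k : ℝ) - m) z I : ℂ) *
        iteratedFDeriv ℝ k (fracMul ((m : ℝ) - k) g) (x - z)
          (fun l => EuclideanSpace.single (I l) (1 : ℝ))) (by
    filter_upwards [ae_ne_zero (N := N) (by omega)] with z hz
    rw [norm_mul, Complex.norm_real, Real.norm_of_nonneg (by positivity)]
    refine (mul_le_mul_of_nonneg_left (norm_sum_radialTensor_mul_le _ _ _ hz _)
      (by positivity)).trans_eq ?_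
    have e : ‖z‖ ^ ((m : ℝ) - N) =
        ‖z‖ ^ (2 * (m : ℝ) - N) * ‖z‖ ^ ((k : ℝ) - m - k) := by
      rw [← Real.rpow_add (norm_pos_iff.2 hz)]; congr 1; ring
    rw [e]; ring)
  rw [hmain, integral_const_mul, norm_mul, Complex.norm_real, Real.norm_eq_abs, abs_mul,
    abs_mul, abs_pow, abs_neg, abs_one, one_pow, one_mul, abs_of_pos hγ, abs_of_pos hlam] at hle
  rw [rieszPotential, hJ]
  have hsq : 0 < Real.sqrt (lam N ((k : ℝ) - m) k) := Real.sqrt_pos.2 hlam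
  have hss := Real.mul_self_sqrt hlam.le
  set L := Real.sqrt (lam N ((k : ℝ) - m) k)
  rw [← hss] at hle
  have h2 : rieszGamma N ((m : ℝ) - k) * L * ‖𝓕⁻ (g : EuclideanSpace ℝ (Fin N) → ℂ) x‖ ≤
      ∫ z, ‖z‖ ^ ((m : ℝ) - N) * G (x - z) := by
    refine le_of_mul_le_mul_left ?_ hsq
    calc _ = rieszGamma N ((m : ℝ) - k) * (L * L) * ‖𝓕⁻ (g : EuclideanSpace ℝ (Fin N) → ℂ) x‖ := by ring
      _ ≤ _ := hle
  have h3 : rieszGamma N (m : ℝ) / (rieszGamma N ((m : ℝ) - k) * L) *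
      (1 / rieszGamma N (m : ℝ) * ∫ z, ‖z‖ ^ ((m : ℝ) - N) * G (x - z)) =
      (∫ z, ‖z‖ ^ ((m : ℝ) - N) * G (x - z)) / (rieszGamma N ((m : ℝ) - k) * L) := by
    field_simp
  rw [h3, le_div_iff₀ (by positivity), mul_comm]
  exact h2

end PotentialEstimate

end

/-! ### From Schwartz data to compactly supported u -/

theorem corollary3p4 (N m k : ℕ) (hmN : m < N) (hk : 1 ≤ k) (hkm : k ≤ m - 1)
    (u : EuclideanSpace ℝ (Fin N) → ℂ) (hu : ContDiff ℝ ∞ u) (hc : HasCompactSupport u)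
    (x : EuclideanSpace ℝ (Fin N)) :
    MeasureTheory.Integrable (fun y : EuclideanSpace ℝ (Fin N) =>
        PotentialEstimate.gradNorm k
          (PotentialEstimate.fracLaplacian ((m : ℝ) - (k : ℝ)) u) y /
            ‖x - y‖ ^ ((N : ℝ) - (m : ℝ))) ∧
      ‖u x‖ ≤
        PotentialEstimate.rieszGamma N (m : ℝ) /
            (PotentialEstimate.rieszGamma N ((m : ℝ) - (k : ℝ)) *
              Real.sqrt (PotentialEstimate.lam N ((k : ℝ) - (m : ℝ)) k)) *
          PotentialEstimate.rieszPotential (m : ℝ)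
            (PotentialEstimate.gradNorm k
              (PotentialEstimate.fracLaplacian ((m : ℝ) - (k : ℝ)) u)) x := by
  let U : SchwartzMap (EuclideanSpace ℝ (Fin N)) ℂ := hc.toSchwartzMap hu
  have hinv : 𝓕⁻ ((𝓕 U : SchwartzMap (EuclideanSpace ℝ (Fin N)) ℂ) :
      EuclideanSpace ℝ (Fin N) → ℂ) x = u x := by
    rw [← SchwartzMap.fourierInv_coe, FourierTransform.fourierInv_fourier_eq]
    rfl
  rw [← hinv]
  -- With g = û, `fracMul` unfolds to `fracLaplacian` of u. The truncated m - 1 still gives k < m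
  -- because k ≥ 1.
  exact PotentialEstimate.norm_fourierInv_le_rieszPotential hmN hk (by omega) (𝓕 U) x
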